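/- Setting. Let $\langle\cdot,\cdot\rangle$ and $\|\cdot\|_2$ be the standard inner product and Euclidean norm on $\mathbb{R}^d$, let $\|\cdot\|$ be an arbitrary norm on $\mathbb{R}^d$ with dual norm $\|u\|_*=\sup_{\|v\|\le 1}\langle u,v\rangle$, and let $\underline\rho,\bar\rho,\underline\theta>0$ be such that $\underline\rho\|u\|_2\le\|u\|_*\le\bar\rho\|u\|_2$ and $\underline\theta\|u\|_2\le\|u\|$ for all $u\in\mathbb{R}^d$. Let $\mathcal D$ be a probability distribution, let $f_\xi:\mathbb{R}^d\to\mathbb{R}$ be twice differentiable for every $\xi$, and let $f(x)=\mathbb{E}_{\xi\sim\mathcal D}[f_\xi(x)]$ (with $f_\xi(x)$ integrable for every $x$) be twice differentiable. Assume, with constants $\sigma_g,\sigma_H,L_0\ge 0$ and $L_1>0$: 1. for all $x,w\in\mathbb{R}^d$: $\mathbb{E}_\xi[\nabla f_\xi(x)]=\nabla f(x)$, $\mathbb{E}_\xi\|\nabla f_\xi(x)-\nabla f(x)\|_2^2\le\sigma_g^2$, $\mathbb{E}_\xi[\nabla^2 f_\xi(x)]=\nabla^2 f(x)$, and $\mathbb{E}_\xi\|(\nabla^2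 f_\xi(x)-\nabla^2 f(x))w\|_2^2\le\sigma_H^2\|w\|_2^2$; 2. $f_{\inf}=\inf_{x} f(x)>-\infty$; 3. for all $x,y\in\mathbb{R}^d$: $\|\nabla f(x)-\nabla f(y)\|_*\le\bigl(L_0+L_1\sup_{\theta\in[0,1]}\|\nabla f(\theta x+(1-\theta)y)\|_*\bigr)\|x-y\|$. Method. Let $K\ge 1$ be an integer, and put $$\hat\eta=\frac{1}{80L_1}\Bigl(\frac{\bar\rho}{\underline\rho}\Bigr)^{-1},\qquad \alpha=\frac{1}{(K+1)^{2/3}},\qquad \eta=\frac{\hat\eta}{(K+1)^{2/3}},\qquad \beta=1-\alpha .$$ Let $x_0\in\mathbb{R}^d$, and let $m_0$ be an integrable random vector in $\mathbb{R}^d$ (for example a deterministic one). For $k=0,1,\dots,K$ let $$x_{k+1}=x_k+\mathrm{lmo}(m_k),\qquad \mathrm{lmo}(m)\in\operatorname*{argmin}_{\|v\|\le\eta}\langle m,v\rangle ,\qquad \hat x_{k+1}=b_{k+1}x_{k+1}+(1-b_{k+1})x_k,$$ $$m_{k+1}=(1-\alpha)\Bigl(m_k+\tfrac{\beta}{1-\alpha}\nabla^2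 f_{\xi_{k+1}}(\hat x_{k+1})(x_{k+1}-x_k)\Bigr)+\alpha\nabla f_{\xi_{k+1}}(x_{k+1}),$$ where $\mathrm{lmo}$ is any measurable selection of minimizers (which may differ from one iteration to the next), $\xi_{k+1}\sim\mathcal D$, $b_{k+1}$ is uniformly distributed on $(0,1)$, and $m_0,\xi_1,b_1,\xi_2,b_2,\dots$ are mutually independent. Theorem. Put $e_0=m_0-\nabla f(x_0)$. Then $\|e_0\|_*$ and $\|\nabla f(x_k)\|_*$, $0\le k\le K$, are integrable, and $$\min_{0\le k\le K}\mathbb{E}\|\nabla f(x_k)\|_*\le\frac{2(f(x_0)-f_{\inf})}{\hat\eta(K+1)^{1/3}}+\frac{4\bigl(\mathbb{E}\|e_0\|_*+\bar\rho\,\sigma_g\bigr)}{(K+1)^{1/3}}+\frac{\hat\eta L_0\exp(L_1\hat\eta)}{(K+1)^{2/3}}$$ $$\qquad+12\,\frac{\bar\rho}{\underline\rho}\,\frac{\hat\eta L_0}{(K+1)^{1/3}}\Bigl(\exp(L_1\hat\eta)+\sqrt{L_1\hat\eta}\,\exp(L_1\hat\eta)+2\Bigr)+8\,\frac{\bar\rho}{\underline\theta}\,\frac{\hat\eta\,\sigma_H}{(K+1)^{1/3}}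 .$$ In particular the left-hand side is $\mathcal O(1/K^{1/3})$. -/

import Mathlib

open MeasureTheory ProbabilityTheory

/-- The space `ℝ^d` with its Euclidean norm and standard inner product. -/
abbrev Rd (d : ℕ) : Type := EuclideanSpace ℝ (Fin d)

/-- The norm `‖u‖_* = sup {⟨u, v⟩ : N v ≤ 1}` dual to a norm `N` on `ℝ^d`. -/
noncomputable def dualNorm {d : ℕ} (N : Seminorm ℝ (Rd d)) (u : Rd d) : ℝ :=
  sSup ((fun v : Rd d => inner ℝ u v) '' {v : Rd d | N v ≤ 1})

/-- The Hessian `∇² g (x)`, as the linear map `w ↦ ∇² g (x) w`. -/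
noncomputable def hess {d : ℕ} (g : Rd d → ℝ) (x : Rd d) : Rd d →L[ℝ] Rd d :=
  fderiv ℝ (gradient g) x

/-- `g` is (Fréchet) twice differentiable on `ℝ^d`; no continuity of the Hessian is asked. -/
def TwiceDifferentiable {d : ℕ} (g : Rd d → ℝ) : Prop :=
  Differentiable ℝ g ∧ Differentiable ℝ (gradient g)

/-- The stochastic gradient and the stochastic Hessian of the random function `F ξ`, `ξ ∼ D`,
are unbiased estimators of the gradient and the Hessian of `f`, with variances (in the Euclidean
norm) bounded by `σg ^ 2` and `σH ^ 2`. -/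
def UnbiasedBoundedVariance {d : ℕ} {Ξ : Type*} [MeasurableSpace Ξ] (D : Measure Ξ)
    (F : Ξ → Rd d → ℝ) (f : Rd d → ℝ) (σg σH : ℝ) : Prop :=
  (∀ x, Integrable (fun ξ => gradient (F ξ) x) D ∧ ∫ ξ, gradient (F ξ) x ∂D = gradient f x) ∧
  (∀ x, Integrable (fun ξ => ‖gradient (F ξ) x - gradient f x‖ ^ 2) D ∧
    ∫ ξ, ‖gradient (F ξ) x - gradient f x‖ ^ 2 ∂D ≤ σg ^ 2) ∧
  (∀ x, Integrable (fun ξ => hess (F ξ) x) D ∧ ∫ ξ, hess (F ξ) x ∂D = hess f x) ∧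
  (∀ x w, Integrable (fun ξ => ‖(hess (F ξ) x - hess f x) w‖ ^ 2) D ∧
    ∫ ξ, ‖(hess (F ξ) x - hess f x) w‖ ^ 2 ∂D ≤ σH ^ 2 * ‖w‖ ^ 2)

/-- `f` is differentiable and its gradient is symmetrically `(L₀, L₁)`-Lipschitz with respect to
the norm `N`. (For a twice differentiable `f` the gradient is continuous, so the supremum over
the segment is that of a bounded function.) -/
def SymmRelaxedSmooth {d : ℕ} (N : Seminorm ℝ (Rd d)) (f : Rd d → ℝ) (L₀ L₁ : ℝ) : Prop :=
  Differentiable ℝ f ∧ ∀ x y : Rd d,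
    dualNorm N (gradient f x - gradient f y) ≤
      (L₀ + L₁ * ⨆ θ : Set.Icc (0 : ℝ) 1,
        dualNorm N (gradient f ((θ : ℝ) • x + (1 - (θ : ℝ)) • y))) * N (x - y)

/-- `lmo m` is, for every `m`, a minimizer of `⟨m, ·⟩` over the `N`-ball of radius `η`. -/
def IsLMO {d : ℕ} (N : Seminorm ℝ (Rd d)) (η : ℝ) (lmo : Rd d → Rd d) : Prop :=
  ∀ m : Rd d, N (lmo m) ≤ η ∧ ∀ v : Rd d, N v ≤ η → (inner ℝ m (lmo m) : ℝ) ≤ inner ℝ m v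

/-- The momentum update of the method with second-order momentum, from the momentum `m` and the
points `x` and `x'` (the old and the new iterate), the function `g` that was sampled, and the
parameter `b` of the point `b x' + (1 - b) x` on the segment where the Hessian is evaluated. -/
noncomputable def momentumUpdate {d : ℕ} (α β : ℝ) (g : Rd d → ℝ) (b : ℝ) (m x x' : Rd d) :
    Rd d :=
  (1 - α) • (m + (β / (1 - α)) • hess g (b • x' + (1 - b) • x) (x' - x)) + α • gradient g x'

/-- The pairs `(x_k, m_k)` produced by the LMO-based method with second-order momentum, with the
Hessian evaluated at a point of the segment `[x_k, x_{k+1}]`. Here `ξ k` and `b k` are the sample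
and the segment parameter drawn in iteration `k`, that is `ξ_{k+1}` and `b_{k+1}`, and `lmo k` is
the linear minimization oracle of iteration `k`. -/
noncomputable def lmoIterates {d : ℕ} {Ξ : Type*} (F : Ξ → Rd d → ℝ)
    (lmo : ℕ → Rd d → Rd d) (α β : ℕ → ℝ) (x₀ m₀ : Rd d) (ξ : ℕ → Ξ) (b : ℕ → ℝ) :
    ℕ → Rd d × Rd d
  | 0 => (x₀, m₀)
  | k + 1 =>
    let x := (lmoIterates F lmo α β x₀ m₀ ξ b k).1
    let m := (lmoIterates F lmo α β x₀ m₀ ξ b k).2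
    let x' := x + lmo k m
    (x', momentumUpdate (α k) (β k) (F (ξ k)) (b k) m x x')

/-! ### Dual norm and the linear minimization oracle. -/

section DualNorm

variable {d : ℕ} {N : Seminorm ℝ (Rd d)} {θlo : ℝ}

/-! Write `g_k` for the dual norm of `∇f(x_k)`, `e_k = m_k - ∇f(x_k)`, and `Δ_k` for the step. The
oracle gives `f(x_{k+1}) ≤ f(x_k) - η g_k + 2η‖e_k‖_* + O(η²)(L₀ + L₁ g_k)` (`descent_step`), so all
rests on summing `‖e_k‖_*`.

Since `β = 1 - α`, one has `e_{k+1} = (1-α)(e_k + S_k) + oracle noise` with `S_k = ∇²f(x̂_{k+1})Δ_k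
- (∇f(x_{k+1}) - ∇f(x_k))`. Averaged over the uniform `b`, the Hessian term is exactly the gradient
increment, so `S_k` has conditional mean zero. But `S_k` is only bounded by a multiple of `η(L₀ + L₁
g_k)`, and a bound on `E g_k` does not control its second moment. The key is to split `S_k` by the
state-dependent factor `κ = L₀/(L₀ + L₁ g_k)` (`constantShare`): `κ S_k` is still mean-zero, is of
order `ηL₀`, and joins the oracle noise, while `(1-κ) S_k` is of order `ηL₁ g_k` and is estimated
pathwise, without using its mean.

Let `T_k` accumulate the mean-zero part, with `T_0 = 0`. Orthogonality of the increments gives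
`E‖T_k‖² ≤ s²/α` (`accumulatedNoise_bound`). The remainder `e_k - T_k` contracts by `1-α` along each
path, so its sum is at most `(‖e_0‖_* + O(ηL₁) ∑ g_k)/α`. Because `η/α = η̂` and `L₁η̂ ≤ 1/80`, this
multiple of `∑ g_k` is absorbed by the left-hand side (`rate_of_absorbed_bound`). The error `e_0`
stays outside `T` and enters only to the first power, so integrability of `m_0` suffices. -/

lemma bddAbove_inner_image_unitBall (hθlo : 0 < θlo) (hθ : ∀ x, θlo * ‖x‖ ≤ N x) (u : Rd d) :
    BddAbove ((fun v : Rd d => inner ℝ u v) '' {v : Rd d | N v ≤ 1}) := by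
  refine ⟨‖u‖ * (1 / θlo), ?_⟩
  rintro _ ⟨v, hv, rfl⟩
  have h1 : ‖v‖ ≤ 1 / θlo := by
    rw [le_div_iff₀ hθlo, mul_comm]
    exact (hθ v).trans hv
  exact (real_inner_le_norm u v).trans (by gcongr)

lemma inner_le_dualNorm_of_le_one (hθlo : 0 < θlo) (hθ : ∀ x, θlo * ‖x‖ ≤ N x) (u : Rd d)
    {v : Rd d} (hv : N v ≤ 1) : inner ℝ u v ≤ dualNorm N u :=
  le_csSup (bddAbove_inner_image_unitBall hθlo hθ u) ⟨v, hv, rfl⟩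

lemma inner_le_dualNorm_mul (hθlo : 0 < θlo) (hθ : ∀ x, θlo * ‖x‖ ≤ N x) (u v : Rd d) :
    inner ℝ u v ≤ dualNorm N u * N v := by
  rcases (apply_nonneg N v).eq_or_lt with h | h
  · have h1 : ‖v‖ = 0 := by
      have := hθ v
      rw [← h] at this
      nlinarith [norm_nonneg v]
    rw [norm_eq_zero.1 h1]
    simp
  · have h1 : N ((N v)⁻¹ • v) ≤ 1 := by
      rw [map_smul_eq_mul, norm_inv, Real.norm_of_nonneg h.le, inv_mul_cancel₀ h.ne']
    have h2 := inner_le_dualNorm_of_le_one hθlo hθ u h1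
    rw [real_inner_smul_right, inv_mul_le_iff₀ h] at h2
    linarith

lemma dualNorm_le_of_forall {u : Rd d} {c : ℝ}
    (h : ∀ v : Rd d, N v ≤ 1 → inner ℝ u v ≤ c) : dualNorm N u ≤ c := by
  refine csSup_le ⟨_, 0, by simp, rfl⟩ ?_
  rintro _ ⟨v, hv, rfl⟩
  exact h v hv

lemma dualNorm_add_le (hθlo : 0 < θlo) (hθ : ∀ x, θlo * ‖x‖ ≤ N x) (u v : Rd d) :
    dualNorm N (u + v) ≤ dualNorm N u + dualNorm N v := by
  refine dualNorm_le_of_forall fun w hw => ?_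
  rw [inner_add_left]
  exact add_le_add (inner_le_dualNorm_of_le_one hθlo hθ u hw)
    (inner_le_dualNorm_of_le_one hθlo hθ v hw)

lemma dualNorm_smul_le (hθlo : 0 < θlo) (hθ : ∀ x, θlo * ‖x‖ ≤ N x) (r : ℝ) (u : Rd d) :
    dualNorm N (r • u) ≤ ‖r‖ * dualNorm N u := by
  refine dualNorm_le_of_forall fun w hw => ?_
  rw [real_inner_smul_left, ← real_inner_smul_right]
  refine (inner_le_dualNorm_mul hθlo hθ u (r • w)).trans ?_
  rw [map_smul_eq_mul, mul_comm]
  have h0 : 0 ≤ dualNorm N u := by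
    simpa using inner_le_dualNorm_of_le_one hθlo hθ u (v := 0) (by simp)
  have : ‖r‖ * N w ≤ ‖r‖ := mul_le_of_le_one_right (norm_nonneg r) hw
  gcongr

/-- The dual norm as a seminorm. -/
noncomputable def dualSeminorm (N : Seminorm ℝ (Rd d)) (hθlo : 0 < θlo)
    (hθ : ∀ x, θlo * ‖x‖ ≤ N x) : Seminorm ℝ (Rd d) :=
  Seminorm.ofSMulLE (dualNorm N)
    (le_antisymm (dualNorm_le_of_forall fun v _ => by simp)
      (by simpa using inner_le_dualNorm_of_le_one hθlo hθ 0 (v := 0) (by simp)))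
    (dualNorm_add_le hθlo hθ) (dualNorm_smul_le hθlo hθ)

lemma IsLMO.inner_le {η : ℝ} {lmo : Rd d → Rd d} (h : IsLMO N η lmo) (hη : 0 < η) (m : Rd d) :
    inner ℝ m (lmo m) ≤ -(η * dualNorm N m) := by
  suffices H : dualNorm N m ≤ -inner ℝ m (lmo m) / η by
    rw [le_div_iff₀ hη] at H
    linarith
  refine dualNorm_le_of_forall fun v hv => ?_
  have h1 : N (-(η • v)) ≤ η := by
    rw [map_neg_eq_map, map_smul_eq_mul, Real.norm_of_nonneg hη.le]
    exact mul_le_of_le_one_right hη.le hv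
  have h2 := (h m).2 _ h1
  rw [inner_neg_right, real_inner_smul_right] at h2
  rw [le_div_iff₀ hη]
  linarith

lemma Seminorm.continuous_of_le_mul_norm {E : Type*} [NormedAddCommGroup E] [NormedSpace ℝ E]
    (q : Seminorm ℝ E) {c : ℝ} (hq : ∀ u, q u ≤ c * ‖u‖) : Continuous q := by
  refine (LipschitzWith.of_dist_le_mul (K := c.toNNReal) fun x y => ?_).continuous
  rw [Real.dist_eq, dist_eq_norm]
  calc |q x - q y| ≤ q (x - y) := abs_sub_map_le_sub q x y
    _ ≤ c * ‖x - y‖ := hq _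
    _ ≤ _ := by gcongr; exact Real.le_coe_toNNReal c

end DualNorm

/-! ### Gradient and Hessian along a short segment. -/

section SymmetricSmoothness

variable {d : ℕ} {N q : Seminorm ℝ (Rd d)} {f : Rd d → ℝ} {L₀ L₁ η : ℝ}

/-- The bound on the variation of `∇ f` along a short segment starting at `x`. -/
noncomputable def localSmoothness (q : Seminorm ℝ (Rd d)) (f : Rd d → ℝ) (L₀ L₁ : ℝ)
    (x : Rd d) : ℝ := 80 / 79 * (L₀ + L₁ * q (gradient f x))

/-- The supremum `G` of the gradient norm on the segment bounds itself: `G ≤ q(∇f x) + (L₀ + L₁G)η`.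
For `L₁η ≤ 1/80` this can be solved for `L₀ + L₁G` in terms of the gradient at the starting point
alone, with loss `1/(1 - 1/80) = 80/79`. -/
lemma gradient_segment_lipschitz (hq : Continuous q) (hf : Continuous (gradient f))
    (hL₀ : 0 ≤ L₀) (hL₁ : 0 < L₁)
    (hs : ∀ x y : Rd d, q (gradient f x - gradient f y) ≤
      (L₀ + L₁ * ⨆ θ : Set.Icc (0 : ℝ) 1, q (gradient f ((θ : ℝ) • x + (1 - (θ : ℝ)) • y)))
        * N (x - y))
    (hη : 0 ≤ η) (hLη : L₁ * η ≤ 1 / 80) {x Δ : Rd d} (hΔ : N Δ ≤ η)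
    {s t : ℝ} (hs0 : s ∈ Set.Icc (0 : ℝ) 1) (ht0 : t ∈ Set.Icc (0 : ℝ) 1) :
    q (gradient f (x + s • Δ) - gradient f (x + t • Δ)) ≤
      localSmoothness q f L₀ L₁ x * (η * |s - t|) := by
  set γ : ℝ → ℝ := fun r => q (gradient f (x + r • Δ)) with hγ
  have hγc : Continuous γ := by fun_prop
  set G : ℝ := sSup (γ '' Set.Icc 0 1) with hG
  have hbdd : BddAbove (γ '' Set.Icc 0 1) := (isCompact_Icc.image hγc).bddAbove
  have hle : ∀ r ∈ Set.Icc (0 : ℝ) 1, γ r ≤ G := fun r hr => le_csSup hbdd ⟨r, hr, rfl⟩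
  have hG0 : 0 ≤ G := (apply_nonneg q _).trans (hle 0 (by simp))
  have key : ∀ a ∈ Set.Icc (0 : ℝ) 1, ∀ b ∈ Set.Icc (0 : ℝ) 1,
      q (gradient f (x + a • Δ) - gradient f (x + b • Δ)) ≤ (L₀ + L₁ * G) * (η * |a - b|) := by
    intro a ha b hb
    refine (hs _ _).trans ?_
    have h1 : (⨆ θ : Set.Icc (0 : ℝ) 1, q (gradient f ((θ : ℝ) • (x + a • Δ)
        + (1 - (θ : ℝ)) • (x + b • Δ)))) ≤ G := by
      refine ciSup_le fun θ => ?_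
      have h2 : (θ : ℝ) • (x + a • Δ) + (1 - (θ : ℝ)) • (x + b • Δ)
          = x + ((θ : ℝ) * a + (1 - θ) * b) • Δ := by module
      rw [h2]
      exact hle _ ((convex_Icc (0 : ℝ) 1) ha hb θ.2.1 (by linarith [θ.2.2]) (by ring))
    have h3 : N (x + a • Δ - (x + b • Δ)) ≤ η * |a - b| := by
      have : x + a • Δ - (x + b • Δ) = (a - b) • Δ := by module
      rw [this, map_smul_eq_mul, Real.norm_eq_abs, mul_comm]
      gcongr
    gcongr
  have hGle : G ≤ q (gradient f x) + (L₀ + L₁ * G) * η := by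
    refine csSup_le ⟨_, 0, by simp, rfl⟩ ?_
    rintro _ ⟨r, hr, rfl⟩
    have h1 := key r hr 0 (by simp)
    have h2 : γ r ≤ q (gradient f x) + q (gradient f (x + r • Δ) - gradient f (x + (0 : ℝ) • Δ)) := by
      refine le_trans (le_of_eq ?_) (map_add_le_add q _ _)
      simp [hγ]
    have h3 : |r - 0| ≤ 1 := by rw [sub_zero, abs_of_nonneg hr.1]; exact hr.2
    have h4 : (L₀ + L₁ * G) * (η * |r - 0|) ≤ (L₀ + L₁ * G) * (η * 1) := by gcongr
    linarith
  have hM : L₀ + L₁ * G ≤ localSmoothness q f L₀ L₁ x := by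
    unfold localSmoothness
    have h1 : L₁ * G ≤ L₁ * (q (gradient f x) + (L₀ + L₁ * G) * η) := by gcongr
    have h2 : L₁ * η * (L₀ + L₁ * G) ≤ 1 / 80 * (L₀ + L₁ * G) := by gcongr
    linarith
  refine (key s hs0 t ht0).trans ?_
  gcongr

lemma hasDerivAt_gradient_segment (hf : Differentiable ℝ (gradient f)) (x Δ : Rd d) (t : ℝ) :
    HasDerivAt (fun s : ℝ => gradient f (x + s • Δ)) (hess f (x + t • Δ) Δ) t := by
  have h1 : HasDerivAt (fun s : ℝ => x + s • Δ) Δ t := by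
    simpa using ((hasDerivAt_id t).smul_const Δ).const_add x
  exact (hf (x + t • Δ)).hasFDerivAt.comp_hasDerivAt t h1

lemma hasDerivAt_segment (hf : Differentiable ℝ f) (x Δ : Rd d) (t : ℝ) :
    HasDerivAt (fun s : ℝ => f (x + s • Δ)) (inner ℝ (gradient f (x + t • Δ)) Δ) t := by
  have h1 : HasDerivAt (fun s : ℝ => x + s • Δ) Δ t := by
    simpa using ((hasDerivAt_id t).smul_const Δ).const_add x
  rw [inner_gradient_left]
  exact (hf (x + t • Δ)).hasFDerivAt.comp_hasDerivAt t h1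

/-- The directional Hessian is a limit of difference quotients of the gradient; at interior `t` all
nearby `s` stay in the segment. -/
lemma hess_segment_le (hq : Continuous q) (hf : Differentiable ℝ (gradient f)) {x Δ : Rd d}
    {M : ℝ}
    (h : ∀ s ∈ Set.Icc (0 : ℝ) 1, ∀ t ∈ Set.Icc (0 : ℝ) 1,
      q (gradient f (x + s • Δ) - gradient f (x + t • Δ)) ≤ M * |s - t|)
    {t : ℝ} (ht : t ∈ Set.Ioo (0 : ℝ) 1) : q (hess f (x + t • Δ) Δ) ≤ M := by
  have h1 := (hasDerivAt_gradient_segment hf x Δ t).tendsto_slope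
  refine le_of_tendsto ((hq.tendsto _).comp h1) ?_
  filter_upwards [self_mem_nhdsWithin, mem_nhdsWithin_of_mem_nhds (Ioo_mem_nhds ht.1 ht.2)]
    with s hst hs
  have hpos : 0 < |s - t| := abs_pos.2 (sub_ne_zero.2 hst)
  simp only [Function.comp, slope_def_module, map_smul_eq_mul, norm_inv, Real.norm_eq_abs]
  rw [inv_mul_le_iff₀ hpos, mul_comm]
  exact h s (Set.Ioo_subset_Icc_self hs) t (Set.Ioo_subset_Icc_self ht)

lemma descent_segment (hf : Differentiable ℝ f) {x Δ : Rd d} {M : ℝ}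
    (hqN : ∀ u v : Rd d, inner ℝ u v ≤ q u * N v) (hΔ : N Δ ≤ η)
    (h : ∀ t ∈ Set.Icc (0 : ℝ) 1, q (gradient f (x + t • Δ) - gradient f x) ≤ M * t) :
    f (x + Δ) ≤ f x + inner ℝ (gradient f x) Δ + M * η / 2 := by
  set ψ : ℝ → ℝ := fun t => f (x + t • Δ) - t * inner ℝ (gradient f x) Δ - M * η * t ^ 2 / 2
  have hψ : ∀ t, HasDerivAt ψ
      (inner ℝ (gradient f (x + t • Δ)) Δ - inner ℝ (gradient f x) Δ - M * η * t) t := by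
    intro t
    have h1 := (hasDerivAt_segment hf x Δ t).sub
      ((hasDerivAt_id t).mul_const (inner ℝ (gradient f x) Δ))
    have h2 := h1.sub (((hasDerivAt_pow 2 t).const_mul (M * η)).div_const 2)
    refine h2.congr_deriv ?_
    push_cast
    ring
  have hanti : AntitoneOn ψ (Set.Icc 0 1) := by
    refine antitoneOn_of_deriv_nonpos (convex_Icc _ _)
      (fun t _ => (hψ t).continuousAt.continuousWithinAt)
      (fun t _ => (hψ t).differentiableAt.differentiableWithinAt) fun t ht => ?_
    have ht' := interior_subset ht
    rw [(hψ t).deriv, ← inner_sub_left]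
    have h3 := (hqN (gradient f (x + t • Δ) - gradient f x) Δ).trans
      (mul_le_mul_of_nonneg_left hΔ (apply_nonneg q _))
    have h4 := mul_le_mul_of_nonneg_right (h t ht') ((apply_nonneg N Δ).trans hΔ)
    nlinarith
  have := hanti (Set.left_mem_Icc.2 zero_le_one) (Set.right_mem_Icc.2 zero_le_one) zero_le_one
  simp only [ψ, zero_smul, one_smul, add_zero] at this
  linarith

end SymmetricSmoothness

/-! ### Joint measurability of the stochastic derivatives. -/

section Measurability

variable {d : ℕ} {Ξ : Type*} [MeasurableSpace Ξ] {F : Ξ → Rd d → ℝ}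

lemma tendsto_difference_quotient {E G : Type*} [NormedAddCommGroup E] [NormedSpace ℝ E]
    [NormedAddCommGroup G] [NormedSpace ℝ G] {g : E → G} {x : E} (hg : DifferentiableAt ℝ g x)
    (w : E) :
    Filter.Tendsto (fun n : ℕ => ((n : ℝ) + 1) • (g (x + ((n : ℝ) + 1)⁻¹ • w) - g x))
      Filter.atTop (nhds (fderiv ℝ g x w)) := by
  have h1 : HasDerivAt (fun s : ℝ => g (x + s • w)) (fderiv ℝ g x w) 0 :=
    hg.hasFDerivAt.hasLineDerivAt w
  have h2 : Filter.Tendsto (fun n : ℕ => ((n : ℝ) + 1)⁻¹) Filter.atTop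
      (nhdsWithin 0 (Set.Ioi 0)) := by
    refine tendsto_nhdsWithin_iff.2 ⟨?_, Filter.Eventually.of_forall fun n => ?_⟩
    · simpa using tendsto_one_div_add_atTop_nhds_zero_nat (𝕜 := ℝ)
    · exact Set.mem_Ioi.2 (by positivity)
  have h3 := h1.tendsto_slope_zero_right.comp h2
  simpa [Function.comp_def] using h3

lemma measurable_uncurry_of_differentiable (hF_meas : ∀ x, Measurable (fun ξ => F ξ x))
    (hF : ∀ ξ, Differentiable ℝ (F ξ)) : Measurable (fun p : Ξ × Rd d => F p.1 p.2) :=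
  (measurable_uncurry_of_continuous_of_measurable (u := fun x ξ => F ξ x)
    (fun ξ => (hF ξ).continuous) hF_meas).comp measurable_swap

/-- `F` is measurable in `ξ` and continuous in `x`, hence jointly measurable; directional
derivatives inherit this as pointwise limits of difference quotients. The same device, applied to
the gradient, handles the Hessian without assuming it continuous. -/
lemma measurable_gradient_uncurry (hF_meas : ∀ x, Measurable (fun ξ => F ξ x))
    (hF : ∀ ξ, Differentiable ℝ (F ξ)) :
    Measurable (fun p : Ξ × Rd d => gradient (F p.1) p.2) := by
  have hm := measurable_uncurry_of_differentiable hF_meas hF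
  have hw : ∀ w : Rd d, Measurable (fun p : Ξ × Rd d => fderiv ℝ (F p.1) p.2 w) := by
    intro w
    refine measurable_of_tendsto_metrizable (f := fun (n : ℕ) (p : Ξ × Rd d) =>
      ((n : ℝ) + 1) • (F p.1 (p.2 + ((n : ℝ) + 1)⁻¹ • w) - F p.1 p.2)) (fun n => ?_)
      (tendsto_pi_nhds.2 fun p => tendsto_difference_quotient (hF p.1 p.2) w)
    have h1 : Measurable (fun p : Ξ × Rd d => F p.1 (p.2 + ((n : ℝ) + 1)⁻¹ • w)) :=
      hm.comp (measurable_fst.prodMk (measurable_snd.add_const _))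
    exact Measurable.const_smul (h1.sub hm) ((n : ℝ) + 1)
  have hsum : (fun p : Ξ × Rd d => gradient (F p.1) p.2) = fun p =>
      ∑ i, fderiv ℝ (F p.1) p.2 (EuclideanSpace.basisFun (Fin d) ℝ i) •
        EuclideanSpace.basisFun (Fin d) ℝ i := by
    funext p
    conv_lhs => rw [← (EuclideanSpace.basisFun (Fin d) ℝ).sum_repr (gradient (F p.1) p.2)]
    refine Finset.sum_congr rfl fun i _ => ?_
    rw [OrthonormalBasis.repr_apply_apply, real_inner_comm, inner_gradient_left]
  rw [hsum]
  exact Finset.measurable_sum _ fun i _ => (hw _).smul_const _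

lemma measurable_hess_uncurry (hF_meas : ∀ x, Measurable (fun ξ => F ξ x))
    (hF : ∀ ξ, TwiceDifferentiable (F ξ)) :
    Measurable (fun p : Ξ × Rd d × Rd d => hess (F p.1) p.2.1 p.2.2) := by
  have hm := measurable_gradient_uncurry hF_meas fun ξ => (hF ξ).1
  refine measurable_of_tendsto_metrizable (f := fun (n : ℕ) (p : Ξ × Rd d × Rd d) =>
      ((n : ℝ) + 1) • (gradient (F p.1) (p.2.1 + ((n : ℝ) + 1)⁻¹ • p.2.2)
        - gradient (F p.1) p.2.1)) (fun n => ?_)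
      (tendsto_pi_nhds.2 fun p => tendsto_difference_quotient ((hF p.1).2 p.2.1) p.2.2)
  have h1 := hm.comp (f := fun p : Ξ × Rd d × Rd d => (p.1, p.2.1 + ((n : ℝ) + 1)⁻¹ • p.2.2))
    (by fun_prop)
  have h2 := hm.comp (f := fun p : Ξ × Rd d × Rd d => (p.1, p.2.1)) (by fun_prop)
  exact Measurable.const_smul (h1.sub h2) ((n : ℝ) + 1)

lemma measurable_hess {f : Rd d → ℝ} (hf : TwiceDifferentiable f) :
    Measurable (fun p : Rd d × Rd d => hess f p.1 p.2) :=
  (measurable_hess_uncurry (Ξ := Unit) (F := fun _ => f) (fun _ => measurable_const)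
    fun _ => hf).comp (f := fun p => ((), p)) (by fun_prop)

end Measurability

/-! ### Second moments on product spaces and orthogonality of a fresh mean-zero increment. -/

section SecondMoments

open scoped ENNReal

variable {α β E : Type*} [MeasurableSpace α] [MeasurableSpace β] [NormedAddCommGroup E]

lemma eLpNorm_two_le_iff {μ : Measure α} {g : α → E} {c : ℝ≥0∞} :
    eLpNorm g 2 μ ≤ c ↔ ∫⁻ a, ‖g a‖ₑ ^ 2 ∂μ ≤ c ^ 2 := by
  have h := eLpNorm_nnreal_pow_eq_lintegral (μ := μ) (f := g) (p := 2) two_ne_zero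
  simp only [ENNReal.coe_ofNat, NNReal.coe_ofNat, ENNReal.rpow_ofNat] at h
  rw [← h]
  exact (ENNReal.pow_le_pow_left_iff two_ne_zero).symm

lemma lintegral_enorm_sq_eq {μ : Measure α} {g : α → E}
    (hg : Integrable (fun a => ‖g a‖ ^ 2) μ) :
    ∫⁻ a, ‖g a‖ₑ ^ 2 ∂μ = ENNReal.ofReal (∫ a, ‖g a‖ ^ 2 ∂μ) := by
  rw [ofReal_integral_eq_lintegral_ofReal hg (Filter.Eventually.of_forall fun a => by positivity)]
  refine lintegral_congr fun a => ?_
  rw [ENNReal.ofReal_pow (norm_nonneg _), ofReal_norm]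

lemma eLpNorm_two_le_ofReal_iff {μ : Measure α} {g : α → E} {C : ℝ} (hC : 0 ≤ C)
    (hg : Integrable (fun a => ‖g a‖ ^ 2) μ) :
    eLpNorm g 2 μ ≤ ENNReal.ofReal C ↔ ∫ a, ‖g a‖ ^ 2 ∂μ ≤ C ^ 2 := by
  rw [eLpNorm_two_le_iff, lintegral_enorm_sq_eq hg, ← ENNReal.ofReal_pow hC,
    ENNReal.ofReal_le_ofReal_iff (by positivity)]

lemma eLpNorm_two_prod_le {μ : Measure α} [IsProbabilityMeasure μ] {ν : Measure β} [SFinite ν]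
    [MeasurableSpace E] [OpensMeasurableSpace E] {φ : α × β → E} (hφ : Measurable φ) {c : ℝ≥0∞}
    (h : ∀ a, eLpNorm (fun b => φ (a, b)) 2 ν ≤ c) : eLpNorm φ 2 (μ.prod ν) ≤ c := by
  rw [eLpNorm_two_le_iff, lintegral_prod _ (by fun_prop)]
  calc _ ≤ ∫⁻ _, c ^ 2 ∂μ := lintegral_mono fun a => eLpNorm_two_le_iff.1 (h a)
    _ = c ^ 2 := by simp

lemma eLpNorm_two_prod_le' {μ : Measure α} [SFinite μ] {ν : Measure β} [IsProbabilityMeasure ν]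
    [MeasurableSpace E] [OpensMeasurableSpace E] {φ : α × β → E} (hφ : Measurable φ) {c : ℝ≥0∞}
    (h : ∀ b, eLpNorm (fun a => φ (a, b)) 2 μ ≤ c) : eLpNorm φ 2 (μ.prod ν) ≤ c := by
  rw [eLpNorm_two_le_iff, lintegral_prod_symm _ (by fun_prop)]
  calc _ ≤ ∫⁻ _, c ^ 2 ∂ν := lintegral_mono fun a => eLpNorm_two_le_iff.1 (h a)
    _ = c ^ 2 := by simp

lemma integral_norm_le_of_integral_sq_le {μ : Measure α} [IsProbabilityMeasure μ] {g : α → E}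
    (hg : MemLp g 2 μ) {C : ℝ} (hC : 0 ≤ C) (h : ∫ a, ‖g a‖ ^ 2 ∂μ ≤ C ^ 2) :
    ∫ a, ‖g a‖ ∂μ ≤ C := by
  have h2 : Integrable (fun a => ‖g a‖ ^ 2) μ := (memLp_two_iff_integrable_sq_norm hg.1).1 hg
  have h1 : Integrable (fun a => ‖g a‖) μ := (hg.integrable one_le_two).norm
  set c := ∫ a, ‖g a‖ ∂μ with hc
  -- Nonnegativity of the variance of `‖g‖` replaces an appeal to Jensen.
  have h3 : 0 ≤ ∫ a, (‖g a‖ ^ 2 - 2 * c * ‖g a‖ + c ^ 2) ∂μ :=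
    integral_nonneg fun a => by
      have := sq_nonneg (‖g a‖ - c)
      simp only [Pi.zero_apply]
      linarith
  rw [integral_add (f := fun a => ‖g a‖ ^ 2 - 2 * c * ‖g a‖) (h2.sub (h1.const_mul _))
    (integrable_const _), integral_sub h2 (h1.const_mul _), integral_const_mul, ← hc, integral_const] at h3
  simp at h3
  exact le_of_sq_le_sq (by linarith) hC

lemma MeasureTheory.MemLp.integrable_real_inner [InnerProductSpace ℝ E] {μ : Measure α}
    {g h : α → E} (hg : MemLp g 2 μ) (hh : MemLp h 2 μ) :
    Integrable (fun a => inner ℝ (g a) (h a)) μ := by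
  refine (((memLp_two_iff_integrable_sq_norm hg.1).1 hg).add
    ((memLp_two_iff_integrable_sq_norm hh.1).1 hh)).mono' (hg.1.inner hh.1)
    (Filter.Eventually.of_forall fun a => ?_)
  have h1 := norm_inner_le_norm (𝕜 := ℝ) (g a) (h a)
  simp only [Pi.add_apply]
  nlinarith [sq_nonneg (‖g a‖ - ‖h a‖), sq_nonneg (‖g a‖ + ‖h a‖)]

lemma integral_inner_prod_eq_zero [InnerProductSpace ℝ E] [CompleteSpace E] {μ : Measure α}
    [IsProbabilityMeasure μ] {ν : Measure β} [IsProbabilityMeasure ν] {T : α → E} {φ : α × β → E}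
    (hT : MemLp T 2 μ) (hφ : MemLp φ 2 (μ.prod ν))
    (hint : ∀ a, Integrable (fun b => φ (a, b)) ν) (hmean : ∀ a, ∫ b, φ (a, b) ∂ν = 0) :
    ∫ p, inner ℝ (T p.1) (φ p) ∂(μ.prod ν) = 0 := by
  have hT' : MemLp (fun p : α × β => T p.1) 2 (μ.prod ν) :=
    hT.comp_measurePreserving measurePreserving_fst
  have h1 : Integrable (fun p => inner ℝ (T p.1) (φ p)) (μ.prod ν) := hT'.integrable_real_inner hφ
  rw [integral_prod _ h1]
  refine integral_eq_zero_of_ae (Filter.Eventually.of_forall fun a => ?_)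
  simp only [Pi.zero_apply]
  rw [integral_inner (hint a), hmean a, inner_zero_right]

variable {Ω : Type*} [MeasurableSpace Ω]

/-- Given the past `Y`, the increment has mean zero over the independent sample `s`, so by Fubini
the cross term with `T(Y)` vanishes and the squares add. -/
lemma martingale_step_second_moment [InnerProductSpace ℝ E] [CompleteSpace E] [MeasurableSpace E]
    [BorelSpace E] [SecondCountableTopology E] {P : Measure Ω} [IsProbabilityMeasure P]
    {ν : Measure β} [IsProbabilityMeasure ν] {Y : Ω → α} {s : Ω → β} (hY : Measurable Y)
    (hs : Measurable s) (hYs : IndepFun Y s P) (hν : P.map s = ν) {T : α → E} (hT : Measurable T)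
    {φ : α × β → E} (hφ : Measurable φ) {C : ℝ} (hC : 0 ≤ C)
    (hφC : ∀ a, eLpNorm (fun b => φ (a, b)) 2 ν ≤ ENNReal.ofReal C)
    (hmean : ∀ a, ∫ b, φ (a, b) ∂ν = 0) (hTY : MemLp (fun ω => T (Y ω)) 2 P) (r : ℝ) :
    MemLp (fun ω => r • T (Y ω) + φ (Y ω, s ω)) 2 P ∧
      ∫ ω, ‖r • T (Y ω) + φ (Y ω, s ω)‖ ^ 2 ∂P ≤ r ^ 2 * ∫ ω, ‖T (Y ω)‖ ^ 2 ∂P + C ^ 2 := by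
  have := Measure.isProbabilityMeasure_map hY.aemeasurable (μ := P)
  have hmap : P.map (fun ω => (Y ω, s ω)) = (P.map Y).prod ν := by
    rw [(indepFun_iff_map_prod_eq_prod_map_map hY.aemeasurable hs.aemeasurable).1 hYs, hν]
  have hpair : MeasurePreserving (fun ω => (Y ω, s ω)) P ((P.map Y).prod ν) :=
    ⟨hY.prodMk hs, hmap⟩
  have hφ2 : eLpNorm φ 2 ((P.map Y).prod ν) ≤ ENNReal.ofReal C := eLpNorm_two_prod_le hφ hφC
  have hφm : MemLp φ 2 ((P.map Y).prod ν) :=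
    ⟨hφ.aestronglyMeasurable, hφ2.trans_lt ENNReal.ofReal_lt_top⟩
  have hZ : MemLp (fun ω => φ (Y ω, s ω)) 2 P := hφm.comp_measurePreserving hpair
  have hZ2 : Integrable (fun ω => ‖φ (Y ω, s ω)‖ ^ 2) P :=
    (memLp_two_iff_integrable_sq_norm hZ.1).1 hZ
  have hT2 : Integrable (fun ω => ‖T (Y ω)‖ ^ 2) P :=
    (memLp_two_iff_integrable_sq_norm hTY.1).1 hTY
  have hZC : ∫ ω, ‖φ (Y ω, s ω)‖ ^ 2 ∂P ≤ C ^ 2 := by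
    rw [← eLpNorm_two_le_ofReal_iff hC hZ2]
    exact (eLpNorm_comp_measurePreserving hφ.aestronglyMeasurable hpair).trans_le hφ2
  have hTm : MemLp T 2 (P.map Y) :=
    (memLp_map_measure_iff hT.aestronglyMeasurable hY.aemeasurable).2 hTY
  have horth : ∫ ω, inner ℝ (T (Y ω)) (φ (Y ω, s ω)) ∂P = 0 := by
    rw [← integral_inner_prod_eq_zero hTm hφm (fun a => ?_) hmean, ← hmap,
      integral_map (hY.prodMk hs).aemeasurable]
    · exact Measurable.aestronglyMeasurable (by fun_prop)
    · refine MemLp.integrable one_le_two ⟨?_, (hφC a).trans_lt ENNReal.ofReal_lt_top⟩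
      exact (hφ.comp measurable_prodMk_left).aestronglyMeasurable
  refine ⟨(hTY.const_smul r).add hZ, ?_⟩
  have hinner := hTY.integrable_real_inner hZ
  have hexp : ∀ ω, ‖r • T (Y ω) + φ (Y ω, s ω)‖ ^ 2 = r ^ 2 * ‖T (Y ω)‖ ^ 2
      + 2 * r * inner ℝ (T (Y ω)) (φ (Y ω, s ω)) + ‖φ (Y ω, s ω)‖ ^ 2 := by
    intro ω
    rw [norm_add_sq_real, norm_smul, mul_pow, Real.norm_eq_abs, sq_abs, real_inner_smul_left]
    ring
  simp_rw [hexp]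
  rw [integral_add (f := fun ω => r ^ 2 * ‖T (Y ω)‖ ^ 2
      + 2 * r * inner ℝ (T (Y ω)) (φ (Y ω, s ω))) ((hT2.const_mul _).add (hinner.const_mul _)) hZ2,
    integral_add (hT2.const_mul _) (hinner.const_mul _), integral_const_mul, integral_const_mul,
    horth]
  linarith

end SecondMoments

/-! ### Independence of the current state from the next sample. -/

section History

variable {Ω A S 𝒴 : Type*} [MeasurableSpace A] [MeasurableSpace S] [MeasurableSpace 𝒴]
  {a : Ω → A} {s : ℕ → Ω → S}

lemma exists_measurable_eq_history {Y : ℕ → Ω → 𝒴} {Φ : ℕ → 𝒴 × S → 𝒴} {Y₀ : A → 𝒴}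
    (hΦ : ∀ k, Measurable (Φ k)) (hY₀ : Measurable Y₀) (h0 : ∀ ω, Y 0 ω = Y₀ (a ω))
    (hstep : ∀ k ω, Y (k + 1) ω = Φ k (Y k ω, s k ω)) (k : ℕ) :
    ∃ g : A × (Finset.range k → S) → 𝒴, Measurable g ∧
      ∀ ω, Y k ω = g (a ω, fun j : Finset.range k => s j ω) := by
  induction k with
  | zero => exact ⟨fun p => Y₀ p.1, by fun_prop, h0⟩
  | succ k ih =>
    obtain ⟨g, hg, hgY⟩ := ih
    refine ⟨fun p => Φ k (g (p.1, fun j : Finset.range k => p.2 ⟨j, Finset.mem_range.2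
      ((Finset.mem_range.1 j.2).trans k.lt_succ_self)⟩), p.2 ⟨k, by simp⟩), ?_, ?_⟩
    · refine (hΦ k).comp (Measurable.prodMk (hg.comp ?_) (by fun_prop))
      exact measurable_fst.prodMk (measurable_pi_lambda _ fun j => by fun_prop)
    · intro ω
      rw [hstep, hgY]

variable [MeasurableSpace Ω] {P : Measure Ω} [IsProbabilityMeasure P]

/-- The law of `(a, h, s_k)` factors twice: `a` is independent of the whole sample sequence, and the
past samples `h` are independent of `s_k`. Reassociating the triple product gives the claim. -/
lemma indepFun_history (ha : Measurable a) (hs : ∀ k, Measurable (s k))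
    (hind : iIndepFun s P) (has : IndepFun a (fun ω k => s k ω) P) (k : ℕ) :
    IndepFun (fun ω => (a ω, fun j : Finset.range k => s j ω)) (s k) P := by
  set h : Ω → (Finset.range k → S) := fun ω j => s j ω with hh
  have hmh : Measurable h := measurable_pi_lambda _ fun j => hs j
  have h1 : IndepFun h (s k) P := by
    have := hind.indepFun_finset (Finset.range k) {k} (by simp) hs
    exact this.comp (ψ := fun v : ({k} : Finset ℕ) → S => v ⟨k, by simp⟩) measurable_id (by fun_prop)
  have h2 : IndepFun a (fun ω => (h ω, s k ω)) P := by
    refine has.comp (ψ := fun v : ℕ → S => ((fun j : Finset.range k => v j), v k))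
      measurable_id ?_
    exact (measurable_pi_lambda _ fun j => measurable_pi_apply _).prodMk (measurable_pi_apply _)
  have h3 : IndepFun a h P := h2.comp (φ := id) (ψ := Prod.fst) measurable_id measurable_fst
  rw [indepFun_iff_map_prod_eq_prod_map_map (by fun_prop) (by fun_prop)] at h1 h2 h3 ⊢
  have hP1 := Measure.isProbabilityMeasure_map ha.aemeasurable (μ := P)
  have hP2 := Measure.isProbabilityMeasure_map hmh.aemeasurable (μ := P)
  have hP3 := Measure.isProbabilityMeasure_map (hs k).aemeasurable (μ := P)
  have h4 : P.map (fun ω => ((a ω, h ω), s k ω)) =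
      (P.map (fun ω => (a ω, h ω, s k ω))).map MeasurableEquiv.prodAssoc.symm := by
    rw [Measure.map_map (by fun_prop) (by fun_prop)]
    rfl
  rw [h4, h2, h1, h3, ← Measure.prodAssoc_prod]
  simp

lemma indepFun_state {Y : ℕ → Ω → 𝒴} {Φ : ℕ → 𝒴 × S → 𝒴} {Y₀ : A → 𝒴}
    (ha : Measurable a) (hs : ∀ k, Measurable (s k))
    (hind : iIndepFun s P) (has : IndepFun a (fun ω k => s k ω) P)
    (hΦ : ∀ k, Measurable (Φ k)) (hY₀ : Measurable Y₀) (h0 : ∀ ω, Y 0 ω = Y₀ (a ω))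
    (hstep : ∀ k ω, Y (k + 1) ω = Φ k (Y k ω, s k ω)) (k : ℕ) :
    Measurable (Y k) ∧ IndepFun (Y k) (s k) P := by
  obtain ⟨g, hg, hgY⟩ := exists_measurable_eq_history hΦ hY₀ h0 hstep k
  have hYk : Y k = fun ω => g (a ω, fun j : Finset.range k => s j ω) := funext hgY
  rw [hYk]
  refine ⟨hg.comp (ha.prodMk (measurable_pi_lambda _ fun j => hs j)), ?_⟩
  exact (indepFun_history ha hs hind has k).comp hg measurable_id

end History

/-! ### Mean-zero part of the momentum error: moments and decomposition. -/

section MomentumNoise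

variable {d : ℕ} {Ξ : Type*}

/-- The mean-zero part of the error made by the momentum update along the step `Δ` from `x`, with
weight `κ` on the deviation of the Hessian of `f` at a random point of the segment from its mean
over the segment. -/
noncomputable def momentumNoise (F : Ξ → Rd d → ℝ) (f : Rd d → ℝ) (α : ℝ) (κ : ℝ) (x Δ : Rd d)
    (p : Ξ × ℝ) : Rd d :=
  (α • (gradient (F p.1) (x + Δ) - gradient f (x + Δ))
    + (1 - α) • (hess (F p.1) (x + p.2 • Δ) - hess f (x + p.2 • Δ)) Δ)
    + ((1 - α) * κ) • (hess f (x + p.2 • Δ) Δ - (gradient f (x + Δ) - gradient f x))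

/-- With `T` the noise accumulated so far, this is the recursion for the error minus the noise. The
sampled function cancels; what drives it is only the share `1 - κ` of the Hessian deviation. -/
lemma momentumUpdate_sub_gradient {F : Ξ → Rd d → ℝ} {f : Rd d → ℝ} {α : ℝ} (hα : α ≠ 1)
    (κ : ℝ) (m x Δ T : Rd d) (ξ : Ξ) (b : ℝ) :
    momentumUpdate α (1 - α) (F ξ) b m x (x + Δ) - gradient f (x + Δ)
        - ((1 - α) • T + momentumNoise F f α κ x Δ (ξ, b)) =
      (1 - α) • ((m - gradient f x - T)
        + (1 - κ) • (hess f (x + b • Δ) Δ - (gradient f (x + Δ) - gradient f x))) := by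
  have h1 : (1 - α) / (1 - α) = 1 := div_self (sub_ne_zero.2 hα.symm)
  have h2 : b • (x + Δ) + (1 - b) • x = x + b • Δ := by module
  simp only [momentumUpdate, momentumNoise, h1, h2, one_smul, add_sub_cancel_left,
    sub_apply]
  module

variable [MeasurableSpace Ξ]

lemma measurable_momentumNoise {F : Ξ → Rd d → ℝ} {f : Rd d → ℝ}
    (hF_meas : ∀ x, Measurable (fun ξ => F ξ x)) (hF : ∀ ξ, TwiceDifferentiable (F ξ))
    (hf : TwiceDifferentiable f) (α : ℝ) {S : Type*} [MeasurableSpace S] {κ : S → ℝ}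
    (hκ : Measurable κ) {x Δ : S → Rd d} (hx : Measurable x) (hΔ : Measurable Δ)
    {ξ : S → Ξ} (hξ : Measurable ξ) {b : S → ℝ} (hb : Measurable b) :
    Measurable (fun s => momentumNoise F f α (κ s) (x s) (Δ s) (ξ s, b s)) := by
  have hgF := measurable_gradient_uncurry hF_meas fun ξ => (hF ξ).1
  have hgf : Measurable (gradient f) := hf.2.continuous.measurable
  have hHF := measurable_hess_uncurry hF_meas hF
  have hHf := measurable_hess hf
  have h1 := hgF.comp (f := fun s => (ξ s, x s + Δ s)) (by fun_prop)
  have h2 := hHF.comp (f := fun s => (ξ s, x s + b s • Δ s, Δ s)) (by fun_prop)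
  have h3 := hHf.comp (f := fun s => (x s + b s • Δ s, Δ s)) (by fun_prop)
  have h4 : Measurable fun s => gradient f (x s + Δ s) := by fun_prop
  have h5 : Measurable fun s => gradient f (x s) := by fun_prop
  unfold momentumNoise
  simp only [sub_apply]
  exact (((h1.sub h4).const_smul α).add ((h2.sub h3).const_smul (1 - α))).add
    ((hκ.const_mul (1 - α)).smul (h3.sub (h4.sub h5)))

instance isProbabilityMeasure_restrict_Ioo_zero_one :
    IsProbabilityMeasure ((volume : Measure ℝ).restrict (Set.Ioo (0 : ℝ) 1)) :=
  ⟨by simp⟩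

/-- The Hessian need not be continuous, but a derivative that is measurable and bounded on the open
interval is integrable, which is enough for the fundamental theorem of calculus. -/
lemma integral_hess_segment {f : Rd d → ℝ} (hf : TwiceDifferentiable f) {x Δ : Rd d} {B : ℝ}
    (hB : ∀ t ∈ Set.Ioo (0 : ℝ) 1, ‖hess f (x + t • Δ) Δ‖ ≤ B) :
    Integrable (fun t : ℝ => hess f (x + t • Δ) Δ) (volume.restrict (Set.Ioo (0 : ℝ) 1)) ∧
      ∫ t in Set.Ioo (0 : ℝ) 1, hess f (x + t • Δ) Δ = gradient f (x + Δ) - gradient f x := by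
  have hm : Measurable (fun t : ℝ => hess f (x + t • Δ) Δ) :=
    (measurable_hess hf).comp (f := fun t : ℝ => (x + t • Δ, Δ)) (by fun_prop)
  have hint : IntegrableOn (fun t : ℝ => hess f (x + t • Δ) Δ) (Set.Ioo (0 : ℝ) 1) :=
    (MemLp.of_bound (p := 1) hm.aestronglyMeasurable B
      ((ae_restrict_iff' measurableSet_Ioo).2 (Filter.Eventually.of_forall hB))).integrable le_rfl
  refine ⟨hint, ?_⟩
  have h := intervalIntegral.integral_eq_sub_of_hasDerivAt (a := 0) (b := 1)
    (fun t _ => hasDerivAt_gradient_segment hf.2 x Δ t)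
    ((intervalIntegrable_iff_integrableOn_Ioo_of_le zero_le_one).2 hint)
  rw [intervalIntegral.integral_of_le zero_le_one, integral_Ioc_eq_integral_Ioo] at h
  simpa using h

variable {D : Measure Ξ} [IsProbabilityMeasure D] {F : Ξ → Rd d → ℝ} {f : Rd d → ℝ} {σg σH : ℝ}

lemma gradientNoise_second_moment (hF_meas : ∀ x, Measurable (fun ξ => F ξ x))
    (hF : ∀ ξ, Differentiable ℝ (F ξ)) (hσg : 0 ≤ σg)
    (hvar : UnbiasedBoundedVariance D F f σg σH) (ν : Measure ℝ) [IsProbabilityMeasure ν]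
    (x : Rd d) :
    MemLp (fun p : Ξ × ℝ => gradient (F p.1) x - gradient f x) 2 (D.prod ν) ∧
      eLpNorm (fun p : Ξ × ℝ => gradient (F p.1) x - gradient f x) 2 (D.prod ν)
        ≤ ENNReal.ofReal σg ∧
      ∫ p : Ξ × ℝ, (gradient (F p.1) x - gradient f x) ∂(D.prod ν) = 0 := by
  have hm : Measurable (fun p : Ξ × ℝ => gradient (F p.1) x - gradient f x) :=
    ((measurable_gradient_uncurry hF_meas hF).comp (f := fun p : Ξ × ℝ => (p.1, x))
      (by fun_prop)).sub_const _
  have h2 := eLpNorm_two_prod_le' (μ := D) (ν := ν) hm fun _ =>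
    (eLpNorm_two_le_ofReal_iff hσg (hvar.2.1 x).1).2 (hvar.2.1 x).2
  refine ⟨⟨hm.aestronglyMeasurable, h2.trans_lt ENNReal.ofReal_lt_top⟩, h2, ?_⟩
  rw [integral_fun_fst (μ := D) (ν := ν) (fun ξ => gradient (F ξ) x - gradient f x),
    integral_sub (hvar.1 x).1 (integrable_const _), (hvar.1 x).2]
  simp

lemma hessNoise_second_moment (hF_meas : ∀ x, Measurable (fun ξ => F ξ x))
    (hF : ∀ ξ, TwiceDifferentiable (F ξ)) (hf : TwiceDifferentiable f) (hσH : 0 ≤ σH)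
    (hvar : UnbiasedBoundedVariance D F f σg σH) (ν : Measure ℝ) [IsProbabilityMeasure ν]
    (x Δ : Rd d) :
    MemLp (fun p : Ξ × ℝ => (hess (F p.1) (x + p.2 • Δ) - hess f (x + p.2 • Δ)) Δ) 2 (D.prod ν) ∧
      eLpNorm (fun p : Ξ × ℝ => (hess (F p.1) (x + p.2 • Δ) - hess f (x + p.2 • Δ)) Δ) 2
        (D.prod ν) ≤ ENNReal.ofReal (σH * ‖Δ‖) ∧
      ∫ p : Ξ × ℝ, (hess (F p.1) (x + p.2 • Δ) - hess f (x + p.2 • Δ)) Δ ∂(D.prod ν) = 0 := by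
  have hm : Measurable
      (fun p : Ξ × ℝ => (hess (F p.1) (x + p.2 • Δ) - hess f (x + p.2 • Δ)) Δ) := by
    simp only [sub_apply]
    exact ((measurable_hess_uncurry hF_meas hF).comp
      (f := fun p : Ξ × ℝ => (p.1, x + p.2 • Δ, Δ)) (by fun_prop)).sub
      ((measurable_hess hf).comp (f := fun p : Ξ × ℝ => (x + p.2 • Δ, Δ)) (by fun_prop))
  have h2 := eLpNorm_two_prod_le' (μ := D) (ν := ν) hm fun b =>
    (eLpNorm_two_le_ofReal_iff (C := σH * ‖Δ‖) (by positivity)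
      (hvar.2.2.2 (x + b • Δ) Δ).1).2 ((hvar.2.2.2 (x + b • Δ) Δ).2.trans_eq (by ring))
  have hL : MemLp (fun p : Ξ × ℝ => (hess (F p.1) (x + p.2 • Δ) - hess f (x + p.2 • Δ)) Δ) 2
      (D.prod ν) := ⟨hm.aestronglyMeasurable, h2.trans_lt ENNReal.ofReal_lt_top⟩
  refine ⟨hL, h2, ?_⟩
  rw [integral_prod_symm _ (hL.integrable one_le_two)]
  refine integral_eq_zero_of_ae (Filter.Eventually.of_forall fun b => ?_)
  have hH := hvar.2.2.1 (x + b • Δ)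
  simp only [Pi.zero_apply]
  rw [← ContinuousLinearMap.integral_apply (φ := fun ξ => hess (F ξ) (x + b • Δ)
    - hess f (x + b • Δ)) (hH.1.sub (integrable_const _)),
    integral_sub hH.1 (integrable_const _), hH.2]
  simp

/-- The gradient noise, the Hessian noise and the weighted segment deviation share `ξ` and `b`, so
their `L²` norms are added by Minkowski rather than in quadrature. Each has mean zero; for the
deviation this is the uniform law of `b`. -/
lemma momentumNoise_second_moment (hF_meas : ∀ x, Measurable (fun ξ => F ξ x))
    (hF : ∀ ξ, TwiceDifferentiable (F ξ)) (hf : TwiceDifferentiable f) (hσg : 0 ≤ σg)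
    (hσH : 0 ≤ σH) (hvar : UnbiasedBoundedVariance D F f σg σH) {α κ W B B' : ℝ}
    (hα0 : 0 ≤ α) (hα1 : α ≤ 1) (hκ : 0 ≤ κ) {x Δ : Rd d} (hW : ‖Δ‖ ≤ W)
    (hB : ∀ t ∈ Set.Ioo (0 : ℝ) 1, ‖hess f (x + t • Δ) Δ‖ ≤ B)
    (hB'0 : 0 ≤ B') (hB' : ∀ t ∈ Set.Ioo (0 : ℝ) 1,
      κ * ‖hess f (x + t • Δ) Δ - (gradient f (x + Δ) - gradient f x)‖ ≤ B') :
    eLpNorm (momentumNoise F f α κ x Δ) 2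
        (D.prod (volume.restrict (Set.Ioo (0 : ℝ) 1)))
      ≤ ENNReal.ofReal (α * σg + σH * W + B') ∧
    ∫ p, momentumNoise F f α κ x Δ p ∂(D.prod (volume.restrict (Set.Ioo (0 : ℝ) 1))) = 0 := by
  set ν : Measure ℝ := volume.restrict (Set.Ioo (0 : ℝ) 1) with hν
  obtain ⟨hg, hg2, hg0⟩ := gradientNoise_second_moment hF_meas (fun ξ => (hF ξ).1) hσg hvar ν (x + Δ)
  obtain ⟨hH, hH2, hH0⟩ := hessNoise_second_moment hF_meas hF hf hσH hvar ν x Δ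
  obtain ⟨hi, hi0⟩ := integral_hess_segment hf hB
  set S : ℝ → Rd d := fun t => hess f (x + t • Δ) Δ - (gradient f (x + Δ) - gradient f x) with hS
  have hSi : Integrable S ν := hi.sub (integrable_const _)
  have hS0 : ∫ t, S t ∂ν = 0 := by
    rw [hS, integral_sub hi (integrable_const _), hi0]
    simp
  have hSm : Measurable S :=
    ((measurable_hess hf).comp (f := fun t : ℝ => (x + t • Δ, Δ)) (by fun_prop)).sub_const _
  have hκS : Measurable (fun p : Ξ × ℝ => ((1 - α) * κ) • S p.2) :=
    (hSm.comp measurable_snd).const_smul ((1 - α) * κ)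
  have hα1' : 0 ≤ 1 - α := sub_nonneg.2 hα1
  have h3 : eLpNorm (fun p : Ξ × ℝ => ((1 - α) * κ) • S p.2) 2 (D.prod ν)
      ≤ ENNReal.ofReal B' := by
    refine eLpNorm_two_prod_le hκS fun _ => ?_
    have hae : ∀ᵐ t ∂ν, ‖((1 - α) * κ) • S t‖ ≤ B' := by
      refine (ae_restrict_iff' measurableSet_Ioo).2 (Filter.Eventually.of_forall fun t ht => ?_)
      rw [norm_smul, Real.norm_of_nonneg (by positivity), mul_assoc]
      refine le_trans ?_ (hB' t ht)
      exact mul_le_of_le_one_left (by positivity) (by linarith)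
    simpa using eLpNorm_le_of_ae_bound (p := 2) hae
  have h3L : MemLp (fun p : Ξ × ℝ => ((1 - α) * κ) • S p.2) 2 (D.prod ν) :=
    ⟨hκS.aestronglyMeasurable, h3.trans_lt ENNReal.ofReal_lt_top⟩
  have hgL := hg.const_smul α
  have hHL := hH.const_smul (1 - α)
  have hdef : momentumNoise F f α κ x Δ =
      (α • (fun p : Ξ × ℝ => gradient (F p.1) (x + Δ) - gradient f (x + Δ))
      + (1 - α) • fun p : Ξ × ℝ => (hess (F p.1) (x + p.2 • Δ) - hess f (x + p.2 • Δ)) Δ)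
      + fun p : Ξ × ℝ => ((1 - α) * κ) • S p.2 := rfl
  constructor
  · rw [hdef]
    refine (eLpNorm_add_le (hgL.add hHL).1 h3L.1 one_le_two).trans ?_
    rw [ENNReal.ofReal_add (by have := (norm_nonneg Δ).trans hW; positivity) hB'0,
      ENNReal.ofReal_add (by positivity) (by have := (norm_nonneg Δ).trans hW; positivity)]
    refine add_le_add ((eLpNorm_add_le hgL.1 hHL.1 one_le_two).trans (add_le_add ?_ ?_)) h3
    · rw [eLpNorm_const_smul, ENNReal.ofReal_mul hα0, ← ofReal_norm, Real.norm_of_nonneg hα0]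
      gcongr
    · rw [eLpNorm_const_smul, ← ofReal_norm, Real.norm_of_nonneg hα1']
      calc _ ≤ ENNReal.ofReal 1 * ENNReal.ofReal (σH * W) := by
            refine mul_le_mul' (ENNReal.ofReal_le_ofReal (by linarith)) (hH2.trans ?_)
            gcongr
        _ = _ := by simp
  · rw [hdef]
    have e1 := hgL.integrable one_le_two
    have e2 := hHL.integrable one_le_two
    have e3 := h3L.integrable one_le_two
    rw [integral_add' (e1.add e2) e3, integral_add' e1 e2]
    simp only [Pi.smul_apply]
    rw [integral_smul, integral_smul, hg0, hH0, integral_smul,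
      integral_fun_snd (μ := D) (ν := ν) S, hS0]
    simp

end MomentumNoise

/-! ### Deterministic inequalities along one trajectory. -/

section Pathwise

variable {d : ℕ} {N q : Seminorm ℝ (Rd d)} {f : Rd d → ℝ} {L₀ L₁ η : ℝ}

/-- The share of the constant `L₀` in the local smoothness constant at `x`. -/
noncomputable def constantShare (q : Seminorm ℝ (Rd d)) (f : Rd d → ℝ) (L₀ L₁ : ℝ)
    (x : Rd d) : ℝ := L₀ / (L₀ + L₁ * q (gradient f x))

lemma constantShare_nonneg (hL₀ : 0 ≤ L₀) (hL₁ : 0 < L₁) (x : Rd d) :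
    0 ≤ constantShare q f L₀ L₁ x := by
  unfold constantShare
  positivity

lemma constantShare_le_one (hL₀ : 0 ≤ L₀) (hL₁ : 0 < L₁) (x : Rd d) :
    constantShare q f L₀ L₁ x ≤ 1 := by
  have h : 0 ≤ L₁ * q (gradient f x) := by positivity
  exact div_le_one_of_le₀ (by linarith) (by linarith)

lemma constantShare_mul_localSmoothness (hL₀ : 0 ≤ L₀) (hL₁ : 0 < L₁) (x : Rd d) :
    constantShare q f L₀ L₁ x * localSmoothness q f L₀ L₁ x = 80 / 79 * L₀ := by
  unfold constantShare localSmoothness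
  have h : 0 ≤ L₁ * q (gradient f x) := by positivity
  rcases (add_nonneg hL₀ h).eq_or_lt with h0 | h0
  -- Vanishing denominator: the share is `0` by the convention for division, consistent with `L₀ =
  -- 0`.
  · have : L₀ = 0 := by linarith
    simp [this]
  · field_simp

lemma one_sub_constantShare_mul_localSmoothness (hL₀ : 0 ≤ L₀) (hL₁ : 0 < L₁) (x : Rd d) :
    (1 - constantShare q f L₀ L₁ x) * localSmoothness q f L₀ L₁ x =
      80 / 79 * (L₁ * q (gradient f x)) := by
  rw [sub_mul, constantShare_mul_localSmoothness hL₀ hL₁, localSmoothness]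
  ring

lemma gradient_sub_le_of_segment
    (hLip : ∀ x Δ : Rd d, N Δ ≤ η → ∀ s ∈ Set.Icc (0 : ℝ) 1, ∀ t ∈ Set.Icc (0 : ℝ) 1,
      q (gradient f (x + s • Δ) - gradient f (x + t • Δ)) ≤
        localSmoothness q f L₀ L₁ x * (η * |s - t|)) {x Δ : Rd d} (hΔ : N Δ ≤ η)
    {t : ℝ} (ht : t ∈ Set.Icc (0 : ℝ) 1) :
    q (gradient f (x + t • Δ) - gradient f x) ≤ localSmoothness q f L₀ L₁ x * η * t := by
  have h := hLip x Δ hΔ t ht 0 (by simp)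
  simpa [abs_of_nonneg ht.1, mul_assoc] using h

lemma hess_segment_le_localSmoothness (hq : Continuous q) (hf : Differentiable ℝ (gradient f))
    (hLip : ∀ x Δ : Rd d, N Δ ≤ η → ∀ s ∈ Set.Icc (0 : ℝ) 1, ∀ t ∈ Set.Icc (0 : ℝ) 1,
      q (gradient f (x + s • Δ) - gradient f (x + t • Δ)) ≤
        localSmoothness q f L₀ L₁ x * (η * |s - t|)) {x Δ : Rd d} (hΔ : N Δ ≤ η)
    {t : ℝ} (ht : t ∈ Set.Ioo (0 : ℝ) 1) :
    q (hess f (x + t • Δ) Δ) ≤ localSmoothness q f L₀ L₁ x * η :=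
  hess_segment_le hq hf (fun s hs t ht => (hLip x Δ hΔ s hs t ht).trans_eq (by ring)) ht

lemma hess_segment_deviation_le (hq : Continuous q) (hf : Differentiable ℝ (gradient f))
    (hLip : ∀ x Δ : Rd d, N Δ ≤ η → ∀ s ∈ Set.Icc (0 : ℝ) 1, ∀ t ∈ Set.Icc (0 : ℝ) 1,
      q (gradient f (x + s • Δ) - gradient f (x + t • Δ)) ≤
        localSmoothness q f L₀ L₁ x * (η * |s - t|)) {x Δ : Rd d} (hΔ : N Δ ≤ η)
    {t : ℝ} (ht : t ∈ Set.Ioo (0 : ℝ) 1) :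
    q (hess f (x + t • Δ) Δ - (gradient f (x + Δ) - gradient f x)) ≤
      2 * (localSmoothness q f L₀ L₁ x * η) := by
  have h1 := hess_segment_le_localSmoothness hq hf hLip (x := x) hΔ ht
  have h2 := gradient_sub_le_of_segment hLip hΔ (x := x) (t := 1) (by simp)
  have h3 := map_sub_le_add q (hess f (x + t • Δ) Δ) (gradient f (x + Δ) - gradient f x)
  rw [one_smul] at h2
  linarith

/-- Replacing `∇f(x)` by `m` costs `η q(m - ∇f x)` twice: once in the inner product with `Δ`, once
in passing from `q m` back to `q(∇f x)`. -/
lemma descent_step (hf : Differentiable ℝ f)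
    (hqN : ∀ u v : Rd d, inner ℝ u v ≤ q u * N v) (hη : 0 < η)
    (hLip : ∀ x Δ : Rd d, N Δ ≤ η → ∀ s ∈ Set.Icc (0 : ℝ) 1, ∀ t ∈ Set.Icc (0 : ℝ) 1,
      q (gradient f (x + s • Δ) - gradient f (x + t • Δ)) ≤
        localSmoothness q f L₀ L₁ x * (η * |s - t|))
    {x m Δ : Rd d} (hΔ : N Δ ≤ η) (hm : inner ℝ m Δ ≤ -(η * q m)) :
    f (x + Δ) ≤ f x - η * q (gradient f x) + 2 * η * q (m - gradient f x)
      + localSmoothness q f L₀ L₁ x * η * η / 2 := by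
  have h1 := descent_segment hf hqN hΔ fun t ht => gradient_sub_le_of_segment hLip (x := x) hΔ ht
  have h2 : inner ℝ (gradient f x) Δ = inner ℝ m Δ + inner ℝ (gradient f x - m) Δ := by
    rw [inner_sub_left]
    ring
  have h3 := (hqN (gradient f x - m) Δ).trans (mul_le_mul_of_nonneg_left hΔ (apply_nonneg q _))
  rw [map_sub_rev] at h3
  have h4 : q (gradient f x) ≤ q m + q (m - gradient f x) := by
    have := map_sub_le_add q m (m - gradient f x)
    rwa [sub_sub_cancel] at this
  have h5 := mul_le_mul_of_nonneg_left h4 hη.le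
  linarith

lemma mul_sum_le_of_contraction {u g : ℕ → ℝ} {α c : ℝ} (hα0 : 0 ≤ α) (hc : 0 ≤ c)
    (hg : ∀ k, 0 ≤ g k) (hu : ∀ k, 0 ≤ u k)
    (hstep : ∀ k, u (k + 1) ≤ (1 - α) * (u k + c * g k)) (n : ℕ) :
    α * ∑ k ∈ Finset.range n, u k ≤ u 0 + c * ∑ k ∈ Finset.range n, g k := by
  -- The final value `u n` is kept on the left so that the contraction telescopes.
  suffices H : α * ∑ k ∈ Finset.range n, u k + u n ≤ u 0 + c * ∑ k ∈ Finset.range n, g k by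
    linarith [hu n]
  induction n with
  | zero => simp
  | succ n ih =>
    rw [Finset.sum_range_succ, Finset.sum_range_succ]
    have h1 : 0 ≤ α * (c * g n) := mul_nonneg hα0 (mul_nonneg hc (hg n))
    linarith [hstep n]

lemma sum_le_of_descent {φ g e u τ : ℕ → ℝ} {α c δ ρ φinf : ℝ} {n : ℕ} (hη : 0 ≤ η)
    (hα0 : 0 < α) (hc : 0 ≤ c) (hg : ∀ k, 0 ≤ g k) (hu : ∀ k, 0 ≤ u k)
    (hstep : ∀ k, u (k + 1) ≤ (1 - α) * (u k + c * g k))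
    (he : ∀ k, e k ≤ u k + ρ * τ k) (hφ : ∀ k, φinf ≤ φ k)
    (hdesc : ∀ k, φ (k + 1) ≤ φ k - η * g k + 2 * η * e k + δ * (L₀ + L₁ * g k)) :
    η * ∑ k ∈ Finset.range n, g k ≤ φ 0 - φinf
      + 2 * η * ((u 0 + c * ∑ k ∈ Finset.range n, g k) / α + ρ * ∑ k ∈ Finset.range n, τ k)
      + δ * (n * L₀ + L₁ * ∑ k ∈ Finset.range n, g k) := by
  have h1 : φ n ≤ φ 0 - η * ∑ k ∈ Finset.range n, g k + 2 * η * ∑ k ∈ Finset.range n, e k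
      + δ * (n * L₀ + L₁ * ∑ k ∈ Finset.range n, g k) := by
    induction n with
    | zero => simp
    | succ n ih =>
      simp only [Finset.sum_range_succ]
      push_cast
      linarith [hdesc n]
  have h2 : ∑ k ∈ Finset.range n, e k ≤
      ∑ k ∈ Finset.range n, u k + ρ * ∑ k ∈ Finset.range n, τ k := by
    rw [Finset.mul_sum, ← Finset.sum_add_distrib]
    exact Finset.sum_le_sum fun k _ => he k
  have h3 : ∑ k ∈ Finset.range n, u k ≤ (u 0 + c * ∑ k ∈ Finset.range n, g k) / α := by
    rw [le_div_iff₀ hα0, mul_comm]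
    exact mul_sum_le_of_contraction hα0.le hc hg hu hstep n
  have h4 := mul_le_mul_of_nonneg_left (h2.trans (add_le_add_left h3 _)) hη
  linarith [hφ n]

end Pathwise

/-! ### Absorption of the gradient sum and substitution of the parameters. -/

section Rate

lemma rate_of_absorbed_bound {G p Δ₀ E₀ ηhat η α s L₀ L₁ ρlo ρhi θlo σg σH : ℝ} (hG : 0 ≤ G)
    (hp : 1 ≤ p) (hηhat : 0 < ηhat) (hL₀ : 0 ≤ L₀) (hL₁ : 0 < L₁) (hρlo : 0 < ρlo)
    (hρ : ρlo ≤ ρhi) (hθlo : 0 < θlo) (hσH : 0 ≤ σH) (hLη : L₁ * ηhat ≤ 1 / 80)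
    (hα : α = 1 / p ^ 2) (hη : η = ηhat / p ^ 2)
    (hs : s = α * σg + σH * (η / θlo) + 160 / 79 * (L₀ * η) / ρlo)
    (h : η * G ≤ Δ₀ + 2 * η * ((E₀ + 160 / 79 * (L₁ * η) * G) / α + ρhi * (p ^ 3 * (s * p)))
      + 80 / 79 * (η * η / 2) * (p ^ 3 * L₀ + L₁ * G)) :
    G / p ^ 3 ≤ 2 * Δ₀ / (ηhat * p) + 4 * (E₀ + ρhi * σg) / p
      + ηhat * L₀ * Real.exp (L₁ * ηhat) / p ^ 2
      + 12 * (ρhi / ρlo) * (ηhat * L₀ / p)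
          * (Real.exp (L₁ * ηhat) + Real.sqrt (L₁ * ηhat) * Real.exp (L₁ * ηhat) + 2)
      + 8 * (ρhi / θlo) * (ηhat * σH / p) := by
  have hp0 : 0 < p := by linarith
  have hρhi : 0 < ρhi := by linarith
  have hexp : 1 ≤ Real.exp (L₁ * ηhat) := Real.one_le_exp (by positivity)
  have hr : 1 ≤ ρhi / ρlo := (one_le_div hρlo).2 hρ
  have hη0 : 0 < η := by rw [hη]; positivity
  have h1 : G ≤ Δ₀ / η + 2 * ((E₀ + 160 / 79 * (L₁ * η) * G) / α + ρhi * (p ^ 3 * (s * p)))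
      + 80 / 79 * (η / 2) * (p ^ 3 * L₀ + L₁ * G) := by
    refine le_of_mul_le_mul_left (h.trans_eq ?_) hη0
    field_simp
  have hηα : η / α = ηhat := by
    rw [hη, hα]
    field_simp
  have h2 : (E₀ + 160 / 79 * (L₁ * η) * G) / α = E₀ * p ^ 2 + 160 / 79 * (L₁ * ηhat) * G := by
    rw [← hηα, hα]
    field_simp
  have hηle : η ≤ ηhat := by
    rw [hη]
    exact div_le_self hηhat.le (one_le_pow₀ hp)
  have h3 : L₁ * ηhat * G ≤ 1 / 80 * G := by gcongr
  have h4 : L₁ * η * G ≤ 1 / 80 * G := le_trans (by gcongr) h3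
  -- The terms in `G` on the right total at most `4/79 + 1/158 = 9/158 < 1/2`, so absorbing them at
  -- most doubles the rest.
  have h5 : G ≤ 2 * (Δ₀ / η + 2 * (E₀ * p ^ 2 + ρhi * (p ^ 3 * (s * p)))
      + 80 / 79 * (η / 2) * (p ^ 3 * L₀)) := by
    rw [h2] at h1
    linarith
  have h6 : G / p ^ 3 ≤ 2 * Δ₀ / (ηhat * p) + 4 * (E₀ + ρhi * σg) / p
      + 80 / 79 * (ηhat * L₀ / p ^ 2)
      + 640 / 79 * (ρhi / ρlo) * (ηhat * L₀ / p) + 4 * (ρhi / θlo) * (ηhat * σH / p) := by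
    rw [div_le_iff₀ (by positivity)]
    refine h5.trans_eq ?_
    rw [hs, hα, hη]
    field_simp
    ring
  refine h6.trans ?_
  have a1 : 0 ≤ ηhat * L₀ / p := by positivity
  have a2 : 0 ≤ (ρhi / θlo) * (ηhat * σH / p) := by positivity
  have a3 : ηhat * L₀ / p ^ 2 ≤ ηhat * L₀ * Real.exp (L₁ * ηhat) / p ^ 2 :=
    div_le_div_of_nonneg_right (le_mul_of_one_le_right (by positivity) hexp) (by positivity)
  have a4 : ηhat * L₀ / p ^ 2 ≤ ηhat * L₀ / p := by
    gcongr
    exact le_self_pow₀ hp two_ne_zero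
  have a5 : ηhat * L₀ / p ≤ (ρhi / ρlo) * (ηhat * L₀ / p) := le_mul_of_one_le_left a1 hr
  -- The exponential factor is at least `1 + 0 + 2 = 3`, so this term leaves ample room for `640/79`
  -- and for the excess `80/79 - 1` of the preceding one.
  have a6 : 12 * (ρhi / ρlo) * (ηhat * L₀ / p) * 3 ≤ 12 * (ρhi / ρlo) * (ηhat * L₀ / p)
      * (Real.exp (L₁ * ηhat) + Real.sqrt (L₁ * ηhat) * Real.exp (L₁ * ηhat) + 2) := by
    refine mul_le_mul_of_nonneg_left ?_ (by positivity)
    have : 0 ≤ Real.sqrt (L₁ * ηhat) * Real.exp (L₁ * ηhat) := by positivity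
    linarith
  linarith

end Rate

/-! ### The method as a Markov recursion that also carries the accumulated noise. -/

section AugmentedIterates

variable {d : ℕ} {Ξ : Type*}

/-- One step of the method on triples `(x, m, T)`, where `T` accumulates the mean-zero noise. -/
noncomputable def augmentedStep (F : Ξ → Rd d → ℝ) (f : Rd d → ℝ) (lmo : Rd d → Rd d) (α : ℝ)
    (κ : Rd d → ℝ) (p : (Rd d × Rd d × Rd d) × (Ξ × ℝ)) : Rd d × Rd d × Rd d :=
  (p.1.1 + lmo p.1.2.1,
    momentumUpdate α (1 - α) (F p.2.1) p.2.2 p.1.2.1 p.1.1 (p.1.1 + lmo p.1.2.1),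
    (1 - α) • p.1.2.2 + momentumNoise F f α (κ p.1.1) p.1.1 (lmo p.1.2.1) (p.2.1, p.2.2))

/-- The iterates of the method together with the accumulated mean-zero noise. -/
noncomputable def augmentedIterates (F : Ξ → Rd d → ℝ) (f : Rd d → ℝ) (lmo : ℕ → Rd d → Rd d)
    (α : ℝ) (κ : Rd d → ℝ) (x₀ m₀ : Rd d) (ξ : ℕ → Ξ) (b : ℕ → ℝ) : ℕ → Rd d × Rd d × Rd d
  | 0 => (x₀, m₀, 0)
  | k + 1 => augmentedStep F f (lmo k) α κ (augmentedIterates F f lmo α κ x₀ m₀ ξ b k, (ξ k, b k))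

lemma augmentedIterates_eq_lmoIterates (F : Ξ → Rd d → ℝ) (f : Rd d → ℝ) (lmo : ℕ → Rd d → Rd d)
    (α : ℝ) (κ : Rd d → ℝ) (x₀ m₀ : Rd d) (ξ : ℕ → Ξ) (b : ℕ → ℝ) (k : ℕ) :
    lmoIterates F lmo (fun _ => α) (fun _ => 1 - α) x₀ m₀ ξ b k =
      ((augmentedIterates F f lmo α κ x₀ m₀ ξ b k).1,
        (augmentedIterates F f lmo α κ x₀ m₀ ξ b k).2.1) := by
  induction k with
  | zero => rfl
  | succ k ih => simp only [lmoIterates, ih, augmentedIterates, augmentedStep]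

variable [MeasurableSpace Ξ]

lemma measurable_augmentedStep {F : Ξ → Rd d → ℝ} {f : Rd d → ℝ} {lmo : Rd d → Rd d} {α : ℝ}
    {κ : Rd d → ℝ} (hF_meas : ∀ x, Measurable (fun ξ => F ξ x))
    (hF : ∀ ξ, TwiceDifferentiable (F ξ)) (hf : TwiceDifferentiable f) (hlmo : Measurable lmo)
    (hκ : Measurable κ) : Measurable (augmentedStep F f lmo α κ) := by
  have h1 := (measurable_gradient_uncurry hF_meas fun ξ => (hF ξ).1).comp
    (f := fun p : (Rd d × Rd d × Rd d) × (Ξ × ℝ) => (p.2.1, p.1.1 + lmo p.1.2.1)) (by fun_prop)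
  have h2 := (measurable_hess_uncurry hF_meas hF).comp
    (f := fun p : (Rd d × Rd d × Rd d) × (Ξ × ℝ) => (p.2.1,
      p.2.2 • (p.1.1 + lmo p.1.2.1) + (1 - p.2.2) • p.1.1, p.1.1 + lmo p.1.2.1 - p.1.1))
    (by fun_prop)
  have h3 := measurable_momentumNoise (S := (Rd d × Rd d × Rd d) × (Ξ × ℝ)) hF_meas hF hf α
    (κ := fun p => κ p.1.1) (by fun_prop) (x := fun p => p.1.1) (by fun_prop)
    (Δ := fun p => lmo p.1.2.1) (by fun_prop) (ξ := fun p => p.2.1) (by fun_prop)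
    (b := fun p => p.2.2) (by fun_prop)
  unfold augmentedStep momentumUpdate
  refine Measurable.prodMk (by fun_prop) (Measurable.prodMk ?_ ?_)
  · have h4 : Measurable fun p : (Rd d × Rd d × Rd d) × (Ξ × ℝ) => p.1.2.1 := by fun_prop
    exact ((h4.add (h2.const_smul ((1 - α) / (1 - α)))).const_smul (1 - α)).add (h1.const_smul α)
  · have h4 : Measurable fun p : (Rd d × Rd d × Rd d) × (Ξ × ℝ) => p.1.2.2 := by fun_prop
    exact (h4.const_smul (1 - α)).add h3

end AugmentedIterates

/-! ### Second moment of the accumulated noise. -/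

section SecondMomentRecursion

/-- The value `s²/α` is a supersolution: the recursion maps it to `s²/α - s²(1-α)`. -/
lemma second_moment_recursion_bound {V : ℕ → ℝ} {α s : ℝ} (hα0 : 0 < α) (hα1 : α ≤ 1)
    (h0 : V 0 = 0) (hV : ∀ k, V (k + 1) ≤ (1 - α) ^ 2 * V k + s ^ 2) (k : ℕ) :
    V k ≤ s ^ 2 / α := by
  induction k with
  | zero => rw [h0]; positivity
  | succ k ih =>
    have h1 : (1 - α) ^ 2 * V k ≤ (1 - α) ^ 2 * (s ^ 2 / α) := by gcongr
    have h2 : 0 ≤ s ^ 2 * (1 - α) := mul_nonneg (sq_nonneg s) (by linarith)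
    have h3 : (1 - α) ^ 2 * (s ^ 2 / α) + s ^ 2 = s ^ 2 / α - s ^ 2 * (1 - α) := by
      field_simp
      ring
    linarith [hV k]

lemma accumulatedNoise_bound {d : ℕ} {Ξ Ω : Type*} [MeasurableSpace Ξ] [MeasurableSpace Ω]
    {ν : Measure (Ξ × ℝ)} [IsProbabilityMeasure ν] {F : Ξ → Rd d → ℝ} {f : Rd d → ℝ}
    (hF_meas : ∀ x, Measurable (fun ξ => F ξ x)) (hF : ∀ ξ, TwiceDifferentiable (F ξ))
    (hf : TwiceDifferentiable f) {P : Measure Ω} [IsProbabilityMeasure P]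
    {lmo : ℕ → Rd d → Rd d} (hlmo : ∀ k, Measurable (lmo k)) {κ : Rd d → ℝ} (hκ : Measurable κ)
    {α s : ℝ} (hα0 : 0 < α) (hα1 : α ≤ 1) (hs : 0 ≤ s)
    (hnoise : ∀ k y m, eLpNorm (momentumNoise F f α (κ y) y (lmo k m)) 2 ν ≤ ENNReal.ofReal s ∧
      ∫ p, momentumNoise F f α (κ y) y (lmo k m) p ∂ν = 0)
    {Y : ℕ → Ω → Rd d × Rd d × Rd d} {S : ℕ → Ω → Ξ × ℝ}
    (hS : ∀ k, Measurable (S k)) (hlaw : ∀ k, P.map (S k) = ν)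
    (hY : ∀ k, Measurable (Y k) ∧ IndepFun (Y k) (S k) P) (hY0 : ∀ ω, (Y 0 ω).2.2 = 0)
    (hstep : ∀ k ω, (Y (k + 1) ω).2.2 = (1 - α) • (Y k ω).2.2 +
      momentumNoise F f α (κ (Y k ω).1) (Y k ω).1 (lmo k (Y k ω).2.1) (S k ω)) (k : ℕ) :
    MemLp (fun ω => (Y k ω).2.2) 2 P ∧ ∫ ω, ‖(Y k ω).2.2‖ ^ 2 ∂P ≤ s ^ 2 / α := by
  have hTs : ∀ k, MemLp (fun ω => (Y k ω).2.2) 2 P → MemLp (fun ω => (Y (k + 1) ω).2.2) 2 P ∧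
      ∫ ω, ‖(Y (k + 1) ω).2.2‖ ^ 2 ∂P ≤ (1 - α) ^ 2 * ∫ ω, ‖(Y k ω).2.2‖ ^ 2 ∂P + s ^ 2 := by
    intro k hk
    have hlmok := hlmo k
    obtain ⟨φ, hφ⟩ : ∃ φ : (Rd d × Rd d × Rd d) × (Ξ × ℝ) → Rd d, ∀ p, φ p =
        momentumNoise F f α (κ p.1.1) p.1.1 (lmo k p.1.2.1) (p.2.1, p.2.2) := ⟨_, fun _ => rfl⟩
    have hm : Measurable φ := by
      have h := measurable_momentumNoise (S := (Rd d × Rd d × Rd d) × (Ξ × ℝ)) hF_meas hF hf α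
        (κ := fun p => κ p.1.1) (by fun_prop) (x := fun p => p.1.1) (by fun_prop)
        (Δ := fun p => lmo k p.1.2.1) (by fun_prop) (ξ := fun p => p.2.1) (by fun_prop)
        (b := fun p => p.2.2) (by fun_prop)
      rwa [← funext hφ] at h
    have hφY : ∀ ω, (Y (k + 1) ω).2.2 = (1 - α) • (Y k ω).2.2 + φ (Y k ω, S k ω) := fun ω => by
      rw [hstep, hφ]
    have hT : Measurable fun y : Rd d × Rd d × Rd d => y.2.2 := by fun_prop
    have hφ1 : ∀ y : Rd d × Rd d × Rd d, eLpNorm (fun z => φ (y, z)) 2 ν ≤ ENNReal.ofReal s :=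
      fun y => by simpa only [hφ] using (hnoise k y.1 y.2.1).1
    have hφ0 : ∀ y : Rd d × Rd d × Rd d, ∫ z, φ (y, z) ∂ν = 0 :=
      fun y => by simpa only [hφ] using (hnoise k y.1 y.2.1).2
    simp only [hφY]
    exact martingale_step_second_moment (hY k).1 (hS k) (hY k).2 (hlaw k) hT hm hs hφ1 hφ0 hk
      (1 - α)
  have hTL : ∀ k, MemLp (fun ω => (Y k ω).2.2) 2 P := by
    intro k
    induction k with
    | zero => rw [funext hY0]; exact MemLp.zero'
    | succ k ih => exact (hTs k ih).1
  exact ⟨hTL k, second_moment_recursion_bound (V := fun k => ∫ ω, ‖(Y k ω).2.2‖ ^ 2 ∂P) hα0 hα1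
    (by simp [hY0]) (fun k => (hTs k (hTL k)).2) k⟩

end SecondMomentRecursion

/-! ### Assembly: the pathwise bound, its expectation, and the minimum against the average. -/

theorem theorem1 {d : ℕ} {Ξ Ω : Type*} [MeasurableSpace Ξ] [MeasurableSpace Ω]
    -- the data distribution and the objective `f x = E_ξ [F ξ x]`
    (D : Measure Ξ) [IsProbabilityMeasure D] (F : Ξ → Rd d → ℝ) (f : Rd d → ℝ)
    (hF_meas : ∀ x, Measurable (fun ξ => F ξ x))
    (hF_diff : ∀ ξ, TwiceDifferentiable (F ξ))
    (hf : ∀ x, Integrable (fun ξ => F ξ x) D ∧ f x = ∫ ξ, F ξ x ∂D)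
    (hf_diff : TwiceDifferentiable f)
    -- an arbitrary norm on `ℝ^d`, compared with the Euclidean norm
    (N : Seminorm ℝ (Rd d)) (hN : ∀ x, N x = 0 → x = 0)
    (ρlo ρhi θlo : ℝ) (hρlo : 0 < ρlo) (hρhi : 0 < ρhi) (hθlo : 0 < θlo)
    (hρ : ∀ u, ρlo * ‖u‖ ≤ dualNorm N u ∧ dualNorm N u ≤ ρhi * ‖u‖)
    (hθ : ∀ x, θlo * ‖x‖ ≤ N x)
    -- the assumptions on the oracles and on the objective
    (σg σH L₀ L₁ : ℝ) (hσg : 0 ≤ σg) (hσH : 0 ≤ σH) (hL₀ : 0 ≤ L₀) (hL₁ : 0 < L₁)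
    (hvar : UnbiasedBoundedVariance D F f σg σH)
    (hbdd : BddBelow (Set.range f))
    (hsmooth : SymmRelaxedSmooth N f L₀ L₁)
    -- the parameters of the method
    (K : ℕ) (hK : 1 ≤ K) (α ηhat η : ℝ)
    (hα : α = 1 / ((K : ℝ) + 1) ^ (2 / 3 : ℝ))
    (hηhat : ηhat = 1 / (80 * L₁) * (ρhi / ρlo)⁻¹)
    (hη : η = ηhat / ((K : ℝ) + 1) ^ (2 / 3 : ℝ))
    (lmo : ℕ → Rd d → Rd d) (hlmo_meas : ∀ k, Measurable (lmo k)) (hlmo : ∀ k, IsLMO N η (lmo k))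
    -- the initial points and the mutually independent samples
    (P : Measure Ω) [IsProbabilityMeasure P] (x₀ : Rd d) (m₀ : Ω → Rd d)
    (ξ : ℕ → Ω → Ξ) (b : ℕ → Ω → ℝ)
    (hm₀_meas : Measurable m₀) (hm₀_int : Integrable m₀ P)
    (hξ_meas : ∀ k, Measurable (ξ k)) (hξ_law : ∀ k, P.map (ξ k) = D)
    (hb_meas : ∀ k, Measurable (b k))
    (hb_law : ∀ k, P.map (b k) = volume.restrict (Set.Ioo (0 : ℝ) 1))
    (hξb_indep : ∀ k, IndepFun (ξ k) (b k) P)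
    (hsample_indep : iIndepFun (fun k ω => (ξ k ω, b k ω)) P)
    (hm₀_indep : IndepFun m₀ (fun ω k => (ξ k ω, b k ω)) P)
    -- the iterates of the method with `β_k = 1 - α_k`
    (x : ℕ → Ω → Rd d)
    (hx : ∀ k ω, x k ω = (lmoIterates F lmo (fun _ => α) (fun _ => 1 - α) x₀ (m₀ ω)
      (fun j => ξ j ω) (fun j => b j ω) k).1) :
    (∀ k ≤ K, Integrable (fun ω => dualNorm N (gradient f (x k ω))) P) ∧
    Integrable (fun ω => dualNorm N (m₀ ω - gradient f x₀)) P ∧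
    (Finset.range (K + 1)).inf' Finset.nonempty_range_add_one
        (fun k => ∫ ω, dualNorm N (gradient f (x k ω)) ∂P) ≤
      2 * (f x₀ - ⨅ y, f y) / (ηhat * ((K : ℝ) + 1) ^ (1 / 3 : ℝ))
      + 4 * ((∫ ω, dualNorm N (m₀ ω - gradient f x₀) ∂P) + ρhi * σg)
          / ((K : ℝ) + 1) ^ (1 / 3 : ℝ)
      + ηhat * L₀ * Real.exp (L₁ * ηhat) / ((K : ℝ) + 1) ^ (2 / 3 : ℝ)
      + 12 * (ρhi / ρlo) * (ηhat * L₀ / ((K : ℝ) + 1) ^ (1 / 3 : ℝ))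
          * (Real.exp (L₁ * ηhat) + Real.sqrt (L₁ * ηhat) * Real.exp (L₁ * ηhat) + 2)
      + 8 * (ρhi / θlo) * (ηhat * σH / ((K : ℝ) + 1) ^ (1 / 3 : ℝ)) := by
  -- the parameters in terms of `p = (K + 1) ^ (1 / 3)`
  obtain ⟨p, hp⟩ : ∃ p, p = ((K : ℝ) + 1) ^ (1 / 3 : ℝ) := ⟨_, rfl⟩
  have hK1 : (1 : ℝ) < (K : ℝ) + 1 := by
    have : (1 : ℝ) ≤ K := by exact_mod_cast hK
    linarith
  have hp1 : 1 < p := hp ▸ Real.one_lt_rpow hK1 (by norm_num)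
  have hp0 : 0 < p := by linarith
  have hp2 : ((K : ℝ) + 1) ^ (2 / 3 : ℝ) = p ^ 2 := by
    rw [hp, ← Real.rpow_natCast, ← Real.rpow_mul (by linarith)]
    norm_num
  have hp3 : (K : ℝ) + 1 = p ^ 3 := by
    rw [hp, ← Real.rpow_natCast, ← Real.rpow_mul (by linarith)]
    norm_num
  rw [← hp, hp2]
  rw [hp2] at hα hη
  have hα0 : 0 < α := by rw [hα]; positivity
  -- Strictness, from `K ≥ 1`, makes `β/(1-α)` equal to one instead of `0/0`.
  have hα1 : α < 1 := by
    rw [hα, div_lt_one (by positivity)]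
    exact one_lt_pow₀ hp1 two_ne_zero
  have hηhat0 : 0 < ηhat := by rw [hηhat]; positivity
  have hη0 : 0 < η := by rw [hη]; positivity
  -- the dual norm
  obtain ⟨q, hqd⟩ : ∃ q : Seminorm ℝ (Rd d), ∀ u, q u = dualNorm N u :=
    ⟨dualSeminorm N hθlo hθ, fun _ => rfl⟩
  have hqN : ∀ u v : Rd d, inner ℝ u v ≤ q u * N v := fun u v => by
    rw [hqd]; exact inner_le_dualNorm_mul hθlo hθ u v
  simp_rw [← hqd] at hρ ⊢
  have hqc : Continuous q := q.continuous_of_le_mul_norm fun u => (hρ u).2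
  have hgc : Continuous (gradient f) := hf_diff.2.continuous
  -- the augmented process
  set κ : Rd d → ℝ := constantShare q f L₀ L₁ with hκ
  have hκm : Measurable κ := by
    have : Measurable fun y => q (gradient f y) := (hqc.comp hgc).measurable
    exact (measurable_const (a := L₀)).div ((this.const_mul L₁).const_add L₀)
  set Y : ℕ → Ω → Rd d × Rd d × Rd d := fun k ω => augmentedIterates F f lmo α κ x₀ (m₀ ω)
    (fun j => ξ j ω) (fun j => b j ω) k with hY
  have hxY : ∀ k ω, x k ω = (Y k ω).1 := fun k ω => by
    rw [hx, augmentedIterates_eq_lmoIterates F f lmo α κ]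
  have hsm : ∀ k, Measurable fun ω => (ξ k ω, b k ω) := fun k => (hξ_meas k).prodMk (hb_meas k)
  have hst := indepFun_state (Y := Y) (Φ := fun k => augmentedStep F f (lmo k) α κ)
    (Y₀ := fun m => (x₀, m, 0)) hm₀_meas hsm hsample_indep hm₀_indep
    (fun k => measurable_augmentedStep hF_meas hF_diff hf_diff (hlmo_meas k) hκm)
    (by fun_prop) (fun _ => rfl) (fun _ _ => rfl)
  have hx0 : ∀ ω, x 0 ω = x₀ := fun ω => by rw [hx]; rfl
  have hxs : ∀ k ω, x (k + 1) ω = x k ω + lmo k (Y k ω).2.1 := fun k ω => by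
    rw [hxY, hxY]; rfl
  have hxm : ∀ k, Measurable (x k) := fun k => by
    rw [funext (hxY k)]
    exact (hst k).1.fst
  -- integrability of the gradients
  have hgint : ∀ k, Integrable (fun ω => q (gradient f (x k ω))) P := by
    intro k
    -- Every step has Euclidean length at most `η/θlo`, so `x_k` stays in a deterministic compact
    -- ball, on which the continuous gradient is bounded.
    have hball : ∀ ω, x k ω ∈ Metric.closedBall x₀ (k * (η / θlo)) := by
      intro ω
      induction k with
      | zero => simp [hx0]
      | succ k ih =>
        have h1 : ‖lmo k (Y k ω).2.1‖ ≤ η / θlo := by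
          rw [le_div_iff₀ hθlo, mul_comm]
          exact (hθ _).trans (hlmo k _).1
        rw [mem_closedBall_iff_norm] at ih ⊢
        rw [hxs, add_sub_right_comm]
        push_cast
        linarith [norm_add_le (x k ω - x₀) (lmo k (Y k ω).2.1)]
    obtain ⟨B, hB⟩ := (isCompact_closedBall x₀ (k * (η / θlo))).bddAbove_image
      (hqc.comp hgc).continuousOn
    refine Integrable.of_bound ((hqc.comp hgc).measurable.comp (hxm k)).aestronglyMeasurable B
      (Filter.Eventually.of_forall fun ω => ?_)
    rw [Real.norm_of_nonneg (apply_nonneg q _)]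
    exact hB ⟨x k ω, hball ω, rfl⟩
  have heint : Integrable (fun ω => q (m₀ ω - gradient f x₀)) P := by
    refine ((hm₀_int.sub (integrable_const (gradient f x₀))).norm.const_mul ρhi).mono'
      (hqc.measurable.comp (hm₀_meas.sub_const _)).aestronglyMeasurable
      (Filter.Eventually.of_forall fun ω => ?_)
    rw [Real.norm_of_nonneg (apply_nonneg q _)]
    exact (hρ _).2
  refine ⟨fun k _ => hgint k, heint, ?_⟩
  have hfinf : ∀ y, ⨅ y, f y ≤ f y := fun y => ciInf_le hbdd y
  have hE0 : 0 ≤ ∫ ω, q (m₀ ω - gradient f x₀) ∂P := integral_nonneg fun ω => apply_nonneg q _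
  -- The bound `L₁η̂ ≤ 1/80` needs `ρlo ≤ ρhi`. This can fail only when `0` is the only vector, and
  -- then the left side is zero.
  rcases lt_or_ge ρhi ρlo with hlt | hρle
  · -- the space is trivial
    have hzero : ∀ u : Rd d, q u = 0 := by
      intro u
      have h1 : ‖u‖ = 0 := by nlinarith [(hρ u).1.trans (hρ u).2, norm_nonneg u]
      rw [norm_eq_zero.1 h1, map_zero]
    refine (Finset.inf'_le _ (Finset.mem_range.2 K.succ_pos)).trans ?_
    simp only [hzero, integral_zero]
    have : 0 ≤ f x₀ - ⨅ y, f y := sub_nonneg.2 (hfinf x₀)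
    positivity
  -- smoothness along the steps
  have hLηhat : L₁ * ηhat ≤ 1 / 80 := by
    rw [hηhat, inv_div]
    have : L₁ * (1 / (80 * L₁) * (ρlo / ρhi)) = 1 / 80 * (ρlo / ρhi) := by field_simp
    rw [this]
    exact mul_le_of_le_one_right (by norm_num) ((div_le_one hρhi).2 hρle)
  have hLη : L₁ * η ≤ 1 / 80 := by
    refine le_trans (mul_le_mul_of_nonneg_left ?_ hL₁.le) hLηhat
    rw [hη]
    exact div_le_self hηhat0.le (one_le_pow₀ hp1.le)
  have hLip : ∀ x Δ : Rd d, N Δ ≤ η → ∀ s ∈ Set.Icc (0 : ℝ) 1, ∀ t ∈ Set.Icc (0 : ℝ) 1,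
      q (gradient f (x + s • Δ) - gradient f (x + t • Δ)) ≤
        localSmoothness q f L₀ L₁ x * (η * |s - t|) := fun x Δ hΔ s hs t ht =>
    gradient_segment_lipschitz hqc hgc hL₀ hL₁
      (fun x y => by simpa only [hqd] using hsmooth.2 x y) hη0.le hLη hΔ hs ht
  -- second moments of the accumulated noise
  obtain ⟨s, hs⟩ : ∃ s, s = α * σg + σH * (η / θlo) + 160 / 79 * (L₀ * η) / ρlo := ⟨_, rfl⟩
  have hs0 : 0 ≤ s := by rw [hs]; positivity
  have hnormq : ∀ u c, q u ≤ c → ‖u‖ ≤ c / ρlo := fun u c h => by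
    rw [le_div_iff₀ hρlo, mul_comm]
    exact (hρ u).1.trans h
  have hnoise : ∀ y Δ : Rd d, N Δ ≤ η →
      eLpNorm (momentumNoise F f α (κ y) y Δ) 2
        (D.prod (volume.restrict (Set.Ioo (0 : ℝ) 1))) ≤ ENNReal.ofReal s ∧
      ∫ p, momentumNoise F f α (κ y) y Δ p ∂(D.prod (volume.restrict (Set.Ioo (0 : ℝ) 1))) = 0 := by
    intro y Δ hΔ
    have hκ0 : 0 ≤ κ y := constantShare_nonneg hL₀ hL₁ y
    rw [hs]
    refine momentumNoise_second_moment hF_meas hF_diff hf_diff hσg hσH hvar hα0.le hα1.le hκ0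
      (B := localSmoothness q f L₀ L₁ y * η / ρlo) ?_ ?_ (by positivity) ?_
    · rw [le_div_iff₀ hθlo, mul_comm]
      exact (hθ Δ).trans hΔ
    · exact fun t ht => hnormq _ _ (hess_segment_le_localSmoothness hqc hf_diff.2 hLip hΔ ht)
    · intro t ht
      refine (mul_le_mul_of_nonneg_left (hnormq _ _
        (hess_segment_deviation_le hqc hf_diff.2 hLip hΔ ht)) hκ0).trans_eq ?_
      have := constantShare_mul_localSmoothness (q := q) (f := f) hL₀ hL₁ y
      calc κ y * (2 * (localSmoothness q f L₀ L₁ y * η) / ρlo)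
          = 2 * (κ y * localSmoothness q f L₀ L₁ y) * η / ρlo := by ring
        _ = _ := by rw [hκ, this]; ring
  have hlaw : ∀ k, P.map (fun ω => (ξ k ω, b k ω)) =
      D.prod (volume.restrict (Set.Ioo (0 : ℝ) 1)) := fun k => by
    rw [(indepFun_iff_map_prod_eq_prod_map_map (hξ_meas k).aemeasurable
      (hb_meas k).aemeasurable).1 (hξb_indep k), hξ_law, hb_law]
  set T : ℕ → Ω → Rd d := fun k ω => (Y k ω).2.2 with hT
  have hT0 : ∀ ω, T 0 ω = 0 := fun _ => rfl
  have hTbound : ∀ k, MemLp (T k) 2 P ∧ ∫ ω, ‖T k ω‖ ^ 2 ∂P ≤ s ^ 2 / α :=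
    accumulatedNoise_bound hF_meas hF_diff hf_diff hlmo_meas hκm hα0 hα1.le hs0
      (fun k y m => hnoise y _ (hlmo k m).1) hsm hlaw hst hT0 (fun _ _ => rfl)
  have hTL : ∀ k, MemLp (T k) 2 P := fun k => (hTbound k).1
  have hTint : ∀ k, Integrable (fun ω => ‖T k ω‖) P := fun k =>
    ((hTL k).integrable one_le_two).norm
  have hTE : ∀ k, ∫ ω, ‖T k ω‖ ∂P ≤ s * p := by
    intro k
    refine integral_norm_le_of_integral_sq_le (hTL k) (by positivity) ?_
    refine (hTbound k).2.trans_eq ?_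
    -- Here `α = 1/p²`, so `s²/α = (s p)²`.
    rw [hα]
    field_simp
  -- the pathwise bound
  have hbae : ∀ᵐ ω ∂P, ∀ k, b k ω ∈ Set.Ioo (0 : ℝ) 1 := by
    refine ae_all_iff.2 fun k => ?_
    have h1 : ∀ᵐ t ∂(P.map (b k)), t ∈ Set.Ioo (0 : ℝ) 1 := by
      rw [hb_law]
      exact ae_restrict_mem measurableSet_Ioo
    exact ae_of_ae_map (hb_meas k).aemeasurable h1
  have hpath : ∀ᵐ ω ∂P, η * ∑ k ∈ Finset.range (K + 1), q (gradient f (x k ω)) ≤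
      f x₀ - (⨅ y, f y) + 2 * η * ((q (m₀ ω - gradient f x₀) + 160 / 79 * (L₁ * η)
        * ∑ k ∈ Finset.range (K + 1), q (gradient f (x k ω))) / α
        + ρhi * ∑ k ∈ Finset.range (K + 1), ‖T k ω‖)
      + 80 / 79 * (η * η / 2) * (p ^ 3 * L₀
        + L₁ * ∑ k ∈ Finset.range (K + 1), q (gradient f (x k ω))) := by
    filter_upwards [hbae] with ω hω
    -- `u` is the error with the accumulated noise removed and `τ` the size of that noise. The
    -- factor in `c` is `2 · 80/79`: the deviation is at most twice the bound on the Hessian along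
    -- the step.
    have h := sum_le_of_descent (L₀ := L₀) (L₁ := L₁) (η := η) (α := α)
      (c := 160 / 79 * (L₁ * η)) (δ := 80 / 79 * (η * η / 2)) (ρ := ρhi) (φinf := ⨅ y, f y)
      (φ := fun k => f (x k ω)) (g := fun k => q (gradient f (x k ω)))
      (e := fun k => q ((Y k ω).2.1 - gradient f (x k ω)))
      (u := fun k => q ((Y k ω).2.1 - gradient f (x k ω) - T k ω)) (τ := fun k => ‖T k ω‖)
      (n := K + 1) hη0.le hα0 (by positivity) (fun k => apply_nonneg q _)
      (fun k => apply_nonneg q _) ?_ ?_ (fun k => hfinf _) ?_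
    · have h00 : (Y 0 ω).2.1 = m₀ ω := rfl
      simp only [hx0, h00, hT0, sub_zero] at h
      rwa [Nat.cast_add, Nat.cast_one, hp3] at h
    · intro k
      have hΔ := (hlmo k (Y k ω).2.1).1
      have h1 := momentumUpdate_sub_gradient (F := F) (f := f) hα1.ne (κ (x k ω)) (Y k ω).2.1
        (x k ω) (lmo k (Y k ω).2.1) (T k ω) (ξ k ω) (b k ω)
      have h2 : (Y (k + 1) ω).2.1 - gradient f (x (k + 1) ω) - T (k + 1) ω =
          momentumUpdate α (1 - α) (F (ξ k ω)) (b k ω) (Y k ω).2.1 (x k ω)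
            (x k ω + lmo k (Y k ω).2.1) - gradient f (x k ω + lmo k (Y k ω).2.1)
          - ((1 - α) • T k ω + momentumNoise F f α (κ (x k ω)) (x k ω) (lmo k (Y k ω).2.1)
            (ξ k ω, b k ω)) := by
        rw [hxs, hxY]
        rfl
      have hκ1 : 0 ≤ 1 - κ (x k ω) := sub_nonneg.2 (constantShare_le_one hL₀ hL₁ _)
      simp only [h2, h1]
      rw [map_smul_eq_mul, Real.norm_of_nonneg (by linarith)]
      refine mul_le_mul_of_nonneg_left ((map_add_le_add q _ _).trans ?_) (by linarith)
      gcongr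
      rw [map_smul_eq_mul, Real.norm_of_nonneg hκ1]
      refine (mul_le_mul_of_nonneg_left
        (hess_segment_deviation_le hqc hf_diff.2 hLip hΔ (hω k)) hκ1).trans_eq ?_
      have h3 := one_sub_constantShare_mul_localSmoothness (q := q) (f := f) hL₀ hL₁ (x k ω)
      calc (1 - κ (x k ω)) * (2 * (localSmoothness q f L₀ L₁ (x k ω) * η))
          = 2 * η * ((1 - κ (x k ω)) * localSmoothness q f L₀ L₁ (x k ω)) := by ring
        _ = _ := by rw [hκ, h3]; ring
    · intro k
      have h1 := map_add_le_add q ((Y k ω).2.1 - gradient f (x k ω) - T k ω) (T k ω)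
      rw [sub_add_cancel] at h1
      linarith [(hρ (T k ω)).2]
    · intro k
      have h1 := descent_step hf_diff.1 hqN hη0 hLip (x := x k ω) (hlmo k (Y k ω).2.1).1
        (by rw [hqd]; exact (hlmo k).inner_le hη0 _)
      simp only [hxs]
      refine h1.trans_eq ?_
      rw [localSmoothness]
      ring
  -- the bound in expectation
  set S : Ω → ℝ := fun ω => ∑ k ∈ Finset.range (K + 1), q (gradient f (x k ω)) with hS
  set R : Ω → ℝ := fun ω => ∑ k ∈ Finset.range (K + 1), ‖T k ω‖ with hR
  have hSint : Integrable S P := integrable_finsetSum _ fun k _ => hgint k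
  have hRint : Integrable R P := integrable_finsetSum _ fun k _ => hTint k
  have hRE : ∫ ω, R ω ∂P ≤ p ^ 3 * (s * p) := by
    rw [hR, integral_finsetSum _ fun k _ => hTint k]
    refine (Finset.sum_le_card_nsmul _ _ _ fun k _ => hTE k).trans_eq ?_
    rw [Finset.card_range, nsmul_eq_mul, Nat.cast_add, Nat.cast_one, hp3]
  have hmain : η * ∫ ω, S ω ∂P ≤ f x₀ - (⨅ y, f y)
      + 2 * η * (((∫ ω, q (m₀ ω - gradient f x₀) ∂P) + 160 / 79 * (L₁ * η) * ∫ ω, S ω ∂P) / α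
        + ρhi * (p ^ 3 * (s * p)))
      + 80 / 79 * (η * η / 2) * (p ^ 3 * L₀ + L₁ * ∫ ω, S ω ∂P) := by
    have i1 : Integrable (fun ω => (q (m₀ ω - gradient f x₀) + 160 / 79 * (L₁ * η) * S ω) / α) P :=
      (heint.add (hSint.const_mul _)).div_const _
    have i2 : Integrable (fun ω => 2 * η * ((q (m₀ ω - gradient f x₀)
        + 160 / 79 * (L₁ * η) * S ω) / α + ρhi * R ω)) P :=
      (i1.add (hRint.const_mul _)).const_mul _
    have i3 : Integrable (fun ω => f x₀ - (⨅ y, f y) + 2 * η * ((q (m₀ ω - gradient f x₀)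
        + 160 / 79 * (L₁ * η) * S ω) / α + ρhi * R ω)) P := (integrable_const _).add i2
    have i4 : Integrable (fun ω => 80 / 79 * (η * η / 2) * (p ^ 3 * L₀ + L₁ * S ω)) P :=
      ((integrable_const _).add (hSint.const_mul _)).const_mul _
    have h1 := integral_mono_ae (hSint.const_mul η) (i3.add i4) hpath
    simp only [Pi.add_apply] at h1
    rw [integral_add i3 i4, integral_add (integrable_const _) i2, integral_const_mul,
      integral_const_mul, integral_const_mul, integral_add i1 (hRint.const_mul _),
      integral_div, integral_add heint (hSint.const_mul _), integral_const_mul,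
      integral_const_mul, integral_add (integrable_const _) (hSint.const_mul _)] at h1
    simp only [integral_const, probReal_univ, one_smul, integral_const_mul] at h1
    refine h1.trans ?_
    gcongr
  have hS0 : 0 ≤ ∫ ω, S ω ∂P := integral_nonneg fun ω => Finset.sum_nonneg fun k _ => apply_nonneg q _
  refine le_trans ?_ (rate_of_absorbed_bound hS0 hp1.le hηhat0 hL₀ hL₁ hρlo hρle hθlo hσH hLηhat
    hα hη hs hmain)
  rw [le_div_iff₀ (by positivity), hS, integral_finsetSum _ fun k _ => hgint k, mul_comm]
  have hmin : ∀ k ∈ Finset.range (K + 1),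
      (Finset.range (K + 1)).inf' Finset.nonempty_range_add_one
        (fun k => ∫ ω, q (gradient f (x k ω)) ∂P) ≤ ∫ ω, q (gradient f (x k ω)) ∂P :=
    fun k hk => Finset.inf'_le _ hk
  refine le_trans (le_of_eq ?_) (Finset.card_nsmul_le_sum _ _ _ hmin)
  rw [Finset.card_range, nsmul_eq_mul, Nat.cast_add, Nat.cast_one, hp3]
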